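/- **Model.** Let $c,\beta,\delta>0$ and $n\ge 1$. Let $\mathbf T=(\lambda_{ij})_{1\le i,j\le n}$ satisfy $\lambda_{ij}\ge 0$ for $i\ne j$, $\lambda_i:=-\lambda_{ii}>0$ and $\lambda_{i,n+1}:=-\sum_{j=1}^n\lambda_{ij}\ge 0$, and assume that from every phase the absorbing state $n+1$ can be reached. Let $\pi_j\ge0$ with $\sum_{j=1}^n\pi_j=1$. The phase process $J$ stays in phase $i$ for an exponential time with rate $\lambda_i$ and then enters state $j\neq i$, $1\le j\le n+1$, with probability $\lambda_{ij}/\lambda_i$. When it enters $n+1$, a claim occurs and $J$ restarts immediately in phase $j$ with probability $\pi_j$. The claims $Y_1,Y_2,\dots$ are i.i.d. exponential with rate $\beta$ and independent of $J$ and of the number $N_t$ of claims up to time $t$. Let $\mathscr F_t$ be the completed natural filtration of the phase and claim processes. For initial phase $i$ and initial surplus $x\ge0$, an admissible strategy is an $(\mathscr F_t)$-predictable, nondecreasing, left-continuous process $D$ with $D_0=0$ such that dividends never exceed the available surplus, i.e. the surplus $X^D_t=x+ct-\sum_{k=1}^{N_t}Y_k-D_t$ can become negative only through a claim. Let $\mathscr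 U_{ad}$ be the set of these strategies (for given $i$ and $x$), $\tau=\inf\{t:X^D_t<0\}$ the ruin time, and $$V_i(x)=\sup_{D\in\mathscr U_{ad}}\mathbb E_{ix}\Big[\int_{0-}^{\tau-}e^{-\delta t}\,\mathrm dD_t\Big],\qquad 1\le i\le n,\ x\ge0,$$ where $\int_{0-}^{\tau-}$ is the integral over $[0,\tau)$ and a lump sum paid at time $t$ is the jump $D_{t+}-D_t$. Let $\tau_1$ be the first jump time of the phase process (a claim counts as a jump) and let $\bar J_{\tau_1}\in\{1,\dots,n+1\}$ be the state entered at $\tau_1$. For Borel functions $W_1,\dots,W_n:[0,\infty)\to[0,\infty]$, extended by $0$ to negative arguments, put $W_{n+1}(y)=\sum_{j=1}^n\pi_j\,\mathbb E[W_j(y-Y)]$, where $Y$ is exponential with rate $\beta$. The one-step problem with terminal payoff $W$ is to maximize over $D\in\mathscr U_{ad}$ $$\mathbb E_{ix}\Big[\int_{0-}^{\tau_1-}e^{-\delta t}\,\mathrm dD_t+e^{-\delta\tau_1}W_{\bar J_{\tau_1}}(X^D_{\tau_1})\Big],$$ where $X^D_{\tau_1}=x+c\tau_1-D_{\tau_1}$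 is the surplus before a claim arriving at $\tau_1$ is deducted. **Proposition.** (1) Every $V_i(x)$ is finite, and $V=(V_i)_{i=1}^n$ is the minimal Borel solution with values in $[0,\infty]$ of the equation $$W_i(x)=\sup_{D\in\mathscr U_{ad}}\mathbb E_{ix}\Big[\int_{0-}^{\tau_1-}e^{-\delta t}\,\mathrm dD_t+e^{-\delta\tau_1}W_{\bar J_{\tau_1}}(X^D_{\tau_1})\Big],\qquad 1\le i\le n,\ x\ge0 .$$ That is, $V$ is a solution, and $V_i(x)\le W_i(x)$ for all $i$ and $x$ for every Borel solution $W$ with values in $[0,\infty]$. (2) Let $b_1^*,\dots,b_n^*\ge0$, and consider the phase-wise barrier strategy with these barriers: while the phase is $j$, any surplus above $b_j^*$ is paid out at once, and at $b_j^*$ the incoming premium is paid out. Explicitly, $$D^*_t=\sup_{0\le s<t}\Big(x+cs-\sum_{k=1}^{N_s}Y_k-b^*_{J_s}\Big)^+,\qquad D^*_0=0 .$$ If, for every initial phase $i$ and every $x\ge 0$, this strategy is optimal for the one-step problem with terminal payoff $V$, then for every $i$ and $x\ge 0$ it is optimal for the full dividend problem, i.e. it is admissible and attains $V_i(x)$.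 -/

import Mathlib

open MeasureTheory ProbabilityTheory Set
open scoped NNReal ENNReal

noncomputable section

/-- Data of the surplus model with phase-type interclaim times of order `n`: premium rate `c`,
claim parameter `β`, discount rate `δ`, the sub-intensity matrix `T` of the phases and the law
`init` of the phase in which the phase process restarts after a claim. -/
structure RiskParams (n : ℕ) where
  c : ℝ
  β : ℝ
  δ : ℝ
  T : Matrix (Fin n) (Fin n) ℝ
  init : Fin n → ℝ
  c_pos : 0 < c
  β_pos : 0 < β
  δ_pos : 0 < δ
  offDiag_nonneg : ∀ i j, i ≠ j → 0 ≤ T i j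
  diag_neg : ∀ i, T i i < 0
  rowSum_nonpos : ∀ i, ∑ j, T i j ≤ 0
  /-- From every phase the absorbing state can be reached, i.e. all phases are transient. -/
  transient : ∀ i, ∃ j, Relation.ReflTransGen (fun a b => 0 < T a b) i j ∧ ∑ k, T j k < 0
  init_nonneg : ∀ i, 0 ≤ init i
  init_sum : ∑ i, init i = 1

/-- The random input consumed by one sojourn of the phase process: for every phase `i`, a holding
time and the state entered at the end of the sojourn in case the sojourn takes place in phase `i`
(the states are `0, …, n - 1` for the phases and `Fin.last n` for the absorbing state); then the
restart phase and the claim size, both used only if the absorbing state is entered. -/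
abbrev StepNoise (n : ℕ) : Type := (Fin n → ℝ≥0 × Fin (n + 1)) × Fin n × ℝ≥0

/-- The sample space: one step noise for every sojourn. -/
abbrev PathSpace (n : ℕ) : Type := ℕ → StepNoise n

/-- A dividend process: `D t ω` is the cumulative amount of dividends up to time `t`. -/
abbrev DividendProcess (n : ℕ) : Type := ℝ≥0 → PathSpace n → ℝ

/-- The exponential law with rate `r`, as a measure on `[0, ∞)`. -/
def expLaw (r : ℝ) : Measure ℝ≥0 := (expMeasure r).map Real.toNNReal

/-- The discrete law with weights `w` on a finite type. -/
def discreteLaw {α : Type*} [Fintype α] [MeasurableSpace α] (w : α → ℝ) : Measure α :=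
  ∑ a, ENNReal.ofReal (w a) • Measure.dirac a

/-- The measure on the time axis with `[s, t) ↦ d t - d s` for a nondecreasing left-continuous `d`
with `d 0 = 0`, which is extended by `0` to negative times. An immediate payment
`d (t+) - d t` is an atom at `t`; in particular the payment at time zero is an atom at `0`. -/
def dividendMeasure (d : ℝ≥0 → ℝ) : Measure ℝ :=
  open Classical in
  if h : Monotone (fun t : ℝ => d t.toNNReal) then h.stieltjesFunction.measure else 0

/-- Extension of a function on `[0, ∞)` by zero to negative surplus values (ruin). -/
def extendZero (w : ℝ≥0 → ℝ≥0∞) (y : ℝ) : ℝ≥0∞ := if 0 ≤ y then w y.toNNReal else 0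

/-- `D` is an optimal element of the set `U` of strategies for the payoff functional `J`. -/
def IsOptimalStrategy {n : ℕ} (U : Set (DividendProcess n)) (J : DividendProcess n → ℝ≥0∞)
    (D : DividendProcess n) : Prop :=
  D ∈ U ∧ ∀ D' ∈ U, J D' ≤ J D

namespace RiskParams

variable {n : ℕ} (p : RiskParams n)

/-! ### The probability space -/

/-- The intensity `λ_i` of leaving phase `i`. -/
def rate (i : Fin n) : ℝ := -p.T i i

/-- The intensity of a claim in phase `i`, i.e. of entering the absorbing state. -/
def exitRate (i : Fin n) : ℝ := -∑ j, p.T i j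

/-- The probability that the state entered upon leaving phase `i` is `a`. -/
def jumpProb (i : Fin n) (a : Fin (n + 1)) : ℝ :=
  Fin.lastCases (motive := fun _ => ℝ) (p.exitRate i / p.rate i)
    (fun j => if j = i then 0 else p.T i j / p.rate i) a

/-- The law of one step noise: all components are independent. -/
def stepLaw : Measure (StepNoise n) :=
  (Measure.pi fun i => (expLaw (p.rate i)).prod (discreteLaw (p.jumpProb i))).prod
    ((discreteLaw p.init).prod (expLaw p.β))

/-- The probability measure: the step noises are independent and identically distributed. -/
def P : Measure (PathSpace n) := Measure.infinitePi fun _ : ℕ => p.stepLaw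

theorem isProbabilityMeasure_expLaw {r : ℝ} (hr : 0 < r) : IsProbabilityMeasure (expLaw r) := by
  have := isProbabilityMeasure_expMeasure hr
  exact Measure.isProbabilityMeasure_map (by fun_prop)

theorem isProbabilityMeasure_discreteLaw {α : Type*} [Fintype α] [MeasurableSpace α] {w : α → ℝ}
    (h0 : ∀ a, 0 ≤ w a) (h1 : ∑ a, w a = 1) : IsProbabilityMeasure (discreteLaw w) := by
  constructor
  simp only [discreteLaw, Measure.coe_finsetSum, Finset.sum_apply, Measure.smul_apply,
    measure_univ, smul_eq_mul, mul_one]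
  rw [← ENNReal.ofReal_sum_of_nonneg (fun a _ => h0 a), h1, ENNReal.ofReal_one]

theorem rate_pos (i : Fin n) : 0 < p.rate i := neg_pos.2 (p.diag_neg i)

theorem jumpProb_nonneg (i : Fin n) (a : Fin (n + 1)) : 0 ≤ p.jumpProb i a := by
  induction a using Fin.lastCases with
  | last =>
    simp only [jumpProb, Fin.lastCases_last]
    exact div_nonneg (neg_nonneg.2 (p.rowSum_nonpos i)) (p.rate_pos i).le
  | cast j =>
    simp only [jumpProb, Fin.lastCases_castSucc]
    split_ifs with h
    · exact le_rfl
    · exact div_nonneg (p.offDiag_nonneg i j (Ne.symm h)) (p.rate_pos i).le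

theorem jumpProb_sum (i : Fin n) : ∑ a, p.jumpProb i a = 1 := by
  have h : ∀ j, (if j = i then 0 else p.T i j / p.rate i)
      = p.T i j / p.rate i - (if j = i then p.T i i / p.rate i else 0) := by
    intro j
    split_ifs with hj
    · subst hj; ring
    · ring
  have hr := (p.rate_pos i).ne'
  rw [Fin.sum_univ_castSucc]
  simp only [jumpProb, Fin.lastCases_last, Fin.lastCases_castSucc, h, Finset.sum_sub_distrib,
    Finset.sum_ite_eq', Finset.mem_univ, if_true, ← Finset.sum_div]
  rw [exitRate]
  field_simp
  rw [rate]
  ring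

instance : IsProbabilityMeasure p.stepLaw := by
  have h1 := fun i => isProbabilityMeasure_expLaw (p.rate_pos i)
  have h2 := fun i => isProbabilityMeasure_discreteLaw (p.jumpProb_nonneg i) (p.jumpProb_sum i)
  have h3 := isProbabilityMeasure_discreteLaw p.init_nonneg p.init_sum
  have h4 := isProbabilityMeasure_expLaw p.β_pos
  unfold stepLaw
  infer_instance

instance : IsProbabilityMeasure p.P := by
  unfold P
  infer_instance

/-! ### Phase process and claim process, for the initial phase `i` -/

/-- The phase occupied during the sojourn number `k`, with the initial phase `i`. -/
def phaseAt (i : Fin n) (ω : PathSpace n) : ℕ → Fin n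
  | 0 => i
  | k + 1 => Fin.lastCases (motive := fun _ => Fin n) (ω k).2.1 (fun j => j)
      ((ω k).1 (phaseAt i ω k)).2

/-- The length of the sojourn number `k`. -/
def hold (i : Fin n) (ω : PathSpace n) (k : ℕ) : ℝ≥0 := ((ω k).1 (phaseAt i ω k)).1

/-- The state, possibly the absorbing one, entered at the end of the sojourn number `k`. -/
def entered (i : Fin n) (ω : PathSpace n) (k : ℕ) : Fin (n + 1) := ((ω k).1 (phaseAt i ω k)).2

/-- The time of the jump number `k`; a claim counts as a jump, and `jumpTime i ω 0 = 0`. -/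
def jumpTime (i : Fin n) (ω : PathSpace n) (k : ℕ) : ℝ≥0 := ∑ m ∈ Finset.range k, hold i ω m

/-- The number of jumps up to and including time `t`. -/
def jumpCount (i : Fin n) (t : ℝ≥0) (ω : PathSpace n) : ℕ := sInf {k | t < jumpTime i ω (k + 1)}

/-- The phase `J_t`. -/
def phase (i : Fin n) (t : ℝ≥0) (ω : PathSpace n) : Fin n := phaseAt i ω (jumpCount i t ω)

/-- The number `N_t` of claims up to and including time `t`. -/
def claimCount (i : Fin n) (t : ℝ≥0) (ω : PathSpace n) : ℕ :=
  ∑ k ∈ Finset.range (jumpCount i t ω), if entered i ω k = Fin.last n then 1 else 0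

/-- The sum of all claims up to and including time `t`. -/
def aggregateClaims (i : Fin n) (t : ℝ≥0) (ω : PathSpace n) : ℝ :=
  ∑ k ∈ Finset.range (jumpCount i t ω),
    if entered i ω k = Fin.last n then ((ω k).2.2 : ℝ) else 0

/-- `s` is the time of a claim. -/
def IsClaimTime (i : Fin n) (s : ℝ≥0) (ω : PathSpace n) : Prop :=
  ∃ k, jumpTime i ω (k + 1) = s ∧ entered i ω k = Fin.last n

theorem measurable_discrete_app {Ω α β : Type*} [MeasurableSpace Ω] [MeasurableSpace α]
    [MeasurableSpace β] [Countable α] [MeasurableSingletonClass α] {f : Ω → α} {g : Ω → α → β}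
    (hf : Measurable f) (hg : ∀ a, Measurable fun ω => g ω a) :
    Measurable fun ω => g ω (f ω) :=
  (measurable_from_prod_countable_left (f := fun q : Ω × α => g q.1 q.2) hg).comp
    (measurable_id.prodMk hf)

theorem measurable_step (k : ℕ) (a : Fin n) : Measurable fun ω : PathSpace n => (ω k).1 a := by
  fun_prop

theorem measurable_phaseAt (i : Fin n) (k : ℕ) :
    Measurable fun ω : PathSpace n => phaseAt i ω k := by
  induction k with
  | zero => exact measurable_const
  | succ k ih =>
    have h : Measurable fun ω : PathSpace n => ((ω k).1 (phaseAt i ω k)).2 :=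
      (measurable_discrete_app ih (measurable_step k)).snd
    have h2 : Measurable fun ω : PathSpace n => (ω k).2.1 := by fun_prop
    exact (measurable_of_countable fun q : Fin n × Fin (n + 1) =>
      Fin.lastCases (motive := fun _ => Fin n) q.1 (fun j => j) q.2).comp (h2.prodMk h)

theorem measurable_hold (i : Fin n) (k : ℕ) :
    Measurable fun ω : PathSpace n => hold i ω k :=
  (measurable_discrete_app (measurable_phaseAt i k) (measurable_step k)).fst

theorem measurable_entered (i : Fin n) (k : ℕ) :
    Measurable fun ω : PathSpace n => entered i ω k :=
  (measurable_discrete_app (measurable_phaseAt i k) (measurable_step k)).snd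

theorem measurable_jumpTime (i : Fin n) (k : ℕ) :
    Measurable fun ω : PathSpace n => jumpTime i ω k :=
  Finset.measurable_sum _ fun m _ => measurable_hold i m

theorem measurable_jumpCount (i : Fin n) (t : ℝ≥0) :
    Measurable fun ω : PathSpace n => jumpCount i t ω := by
  have hm : ∀ k, MeasurableSet {ω : PathSpace n | t < jumpTime i ω (k + 1)} := fun k =>
    measurableSet_lt measurable_const (measurable_jumpTime i (k + 1))
  refine measurable_to_countable' fun k => ?_
  have : (fun ω : PathSpace n => jumpCount i t ω) ⁻¹' {k} =
      {ω | (t < jumpTime i ω (k + 1) ∧ ∀ m < k, ¬ t < jumpTime i ω (m + 1)) ∨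
        (k = 0 ∧ ∀ m, ¬ t < jumpTime i ω (m + 1))} := by
    ext ω
    simp only [mem_preimage, mem_singleton_iff, mem_ofPred_eq, jumpCount]
    constructor
    · rintro rfl
      by_cases hne : {k | t < jumpTime i ω (k + 1)}.Nonempty
      · exact Or.inl ⟨Nat.sInf_mem hne, fun m hm => Nat.notMem_of_lt_sInf hm⟩
      · rw [Set.not_nonempty_iff_eq_empty] at hne
        refine Or.inr ⟨by rw [hne, Nat.sInf_empty], fun m hm => ?_⟩
        have : m ∈ {k | t < jumpTime i ω (k + 1)} := hm
        simp [hne] at this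
    · rintro (⟨h1, h2⟩ | ⟨rfl, h⟩)
      · refine le_antisymm (Nat.sInf_le h1) (not_lt.1 fun hlt => ?_)
        exact h2 _ hlt (Nat.sInf_mem (s := {k | t < jumpTime i ω (k + 1)}) ⟨k, h1⟩)
      · rw [show {k | t < jumpTime i ω (k + 1)} = ∅ from
          Set.eq_empty_of_forall_notMem fun m hm => h m hm, Nat.sInf_empty]
  rw [this]
  simp only [ofPred_or, ofPred_and, ofPred_forall]
  refine MeasurableSet.union ((hm k).inter ?_) (MeasurableSet.inter (MeasurableSet.const _) ?_)
  · exact MeasurableSet.iInter fun m => MeasurableSet.iInter fun _ => (hm m).compl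
  · exact MeasurableSet.iInter fun m => (hm m).compl

theorem measurable_phase (i : Fin n) (t : ℝ≥0) :
    Measurable (phase i t : PathSpace n → Fin n) :=
  measurable_discrete_app (g := fun ω k => phaseAt i ω k) (measurable_jumpCount i t)
    (measurable_phaseAt i)

theorem measurable_claimCount (i : Fin n) (t : ℝ≥0) :
    Measurable (claimCount i t : PathSpace n → ℕ) :=
  measurable_discrete_app
    (g := fun ω m => ∑ k ∈ Finset.range m, if entered i ω k = Fin.last n then 1 else 0)
    (measurable_jumpCount i t) fun _ => Finset.measurable_sum _ fun k _ =>
      Measurable.ite (measurable_entered i k (measurableSet_singleton _))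
        measurable_const measurable_const

theorem measurable_aggregateClaims (i : Fin n) (t : ℝ≥0) :
    Measurable (aggregateClaims i t : PathSpace n → ℝ) :=
  measurable_discrete_app
    (g := fun ω m => ∑ k ∈ Finset.range m,
      if entered i ω k = Fin.last n then ((ω k).2.2 : ℝ) else 0)
    (measurable_jumpCount i t) fun _ => Finset.measurable_sum _ fun k _ =>
      Measurable.ite (measurable_entered i k (measurableSet_singleton _))
        (by fun_prop) measurable_const

/-- The natural filtration of the phase process and the claim process. -/
def naturalFiltration (i : Fin n) : Filtration ℝ≥0 (inferInstance : MeasurableSpace (PathSpace n))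
    where
  seq t := ⨆ s ≤ t, MeasurableSpace.comap
    (fun ω => (phase i s ω, claimCount i s ω, aggregateClaims i s ω)) inferInstance
  mono' _ _ h := biSup_mono fun _ => ge_trans h
  le' _ := iSup₂_le fun s _ => ((measurable_phase i s).prodMk
    ((measurable_claimCount i s).prodMk (measurable_aggregateClaims i s))).comap_le

theorem eventuallyMeasurableSpace_mono {α : Type*} {l : Filter α} [CountableInterFilter l]
    {m₁ m₂ : MeasurableSpace α} (h : m₁ ≤ m₂) :
    eventuallyMeasurableSpace m₁ l ≤ eventuallyMeasurableSpace m₂ l :=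
  fun _ ⟨t, ht, hst⟩ => ⟨t, h t ht, hst⟩

/-- The completed filtration `𝓕_t`: all `P`-null sets are added to the natural filtration. It is a
filtration on the completed σ-algebra. -/
def completeFiltration (i : Fin n) :
    Filtration ℝ≥0 (eventuallyMeasurableSpace inferInstance (ae p.P)) where
  seq t := eventuallyMeasurableSpace (naturalFiltration i t) (ae p.P)
  mono' _ _ h := eventuallyMeasurableSpace_mono ((naturalFiltration i).mono h)
  le' t := eventuallyMeasurableSpace_mono ((naturalFiltration i).le t)

/-! ### The dividend problem, for the initial phase `i` and the initial surplus `x` -/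

/-- The surplus without dividends. -/
def reserve (i : Fin n) (x t : ℝ≥0) (ω : PathSpace n) : ℝ :=
  x + p.c * t - aggregateClaims i t ω

/-- The surplus `X_t^D`. -/
def surplus (i : Fin n) (x : ℝ≥0) (D : DividendProcess n) (t : ℝ≥0) (ω : PathSpace n) : ℝ :=
  p.reserve i x t ω - D t ω

/-- The time of ruin `inf {t | X_t^D < 0}`, equal to `∞` if there is no ruin. -/
def ruinTime (i : Fin n) (x : ℝ≥0) (D : DividendProcess n) (ω : PathSpace n) : ℝ≥0∞ :=
  ⨅ (t : ℝ≥0) (_ : p.surplus i x D t ω < 0), (t : ℝ≥0∞)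

/-- Admissible dividend strategies: predictable, nondecreasing, left-continuous (right limits exist
by monotonicity), and dividends never exceed the available surplus: the surplus can become negative
only by a claim. -/
structure IsAdmissible (i : Fin n) (x : ℝ≥0) (D : DividendProcess n) : Prop where
  predictable : IsStronglyPredictable (p.completeFiltration i) D
  monotone : ∀ ω, Monotone fun t => D t ω
  leftContinuous : ∀ ω t, ContinuousWithinAt (fun t => D t ω) (Iic t) t
  zero : ∀ ω, D 0 ω = 0
  solvent : ∀ᵐ ω ∂p.P, ∀ t, p.surplus i x D t ω < 0 →
    ∃ s ≤ t, IsClaimTime i s ω ∧ p.surplus i x D s ω < 0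

/-- The set of admissible strategies. -/
def admissible (i : Fin n) (x : ℝ≥0) : Set (DividendProcess n) := {D | p.IsAdmissible i x D}

/-- The present value of the dividends paid in the set `A` of times. -/
def discounted (A : Set ℝ) (d : ℝ≥0 → ℝ) : ℝ≥0∞ :=
  ∫⁻ t in A, ENNReal.ofReal (Real.exp (-p.δ * t)) ∂dividendMeasure d

/-- The expected discounted dividends paid strictly before ruin, `V_i^D(x)`. -/
def payoff (i : Fin n) (x : ℝ≥0) (D : DividendProcess n) : ℝ≥0∞ :=
  ∫⁻ ω, p.discounted {t | 0 ≤ t ∧ ENNReal.ofReal t < p.ruinTime i x D ω} (fun t => D t ω) ∂p.P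

/-- The optimal value function `V_i(x)`. -/
def value (i : Fin n) (x : ℝ≥0) : ℝ≥0∞ := ⨆ D ∈ p.admissible i x, p.payoff i x D

/-- The family `W_1, …, W_n` completed by `W_{n+1}(y) = ∑ π_j E[W_j(y - Y)]`, the value at a claim
epoch as a function of the surplus `y` just before the claim is deducted. All the functions vanish
at negative arguments. -/
def terminal (W : Fin n → ℝ≥0 → ℝ≥0∞) (a : Fin (n + 1)) : ℝ → ℝ≥0∞ :=
  Fin.lastCases (motive := fun _ => ℝ → ℝ≥0∞)
    (fun y => ∑ j, ENNReal.ofReal (p.init j) * ∫⁻ u : ℝ≥0, extendZero (W j) (y - u) ∂expLaw p.β)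
    (fun j => extendZero (W j)) a

/-- The expected payoff of the one-step problem with terminal payoff `W`: the discounted dividends
paid strictly before the first jump time `τ₁`, plus the discounted terminal payoff in the state
entered at `τ₁`. There is no claim before `τ₁`, so the surplus at `τ₁`, before the deduction of a
claim arriving at `τ₁`, is `x + c τ₁ - D_{τ₁}`. -/
def oneStepPayoff (W : Fin n → ℝ≥0 → ℝ≥0∞) (i : Fin n) (x : ℝ≥0) (D : DividendProcess n) : ℝ≥0∞ :=
  ∫⁻ ω, (p.discounted (Ico 0 (jumpTime i ω 1 : ℝ)) (fun t => D t ω) +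
    ENNReal.ofReal (Real.exp (-p.δ * jumpTime i ω 1)) *
      p.terminal W (entered i ω 0) (x + p.c * jumpTime i ω 1 - D (jumpTime i ω 1) ω)) ∂p.P

/-- The value of the one-step problem with terminal payoff `W`. -/
def oneStepValue (W : Fin n → ℝ≥0 → ℝ≥0∞) (i : Fin n) (x : ℝ≥0) : ℝ≥0∞ :=
  ⨆ D ∈ p.admissible i x, p.oneStepPayoff W i x D

/-- `W` is a nonnegative (Borel measurable) solution of the one-step dynamic programming
equation. -/
def IsSolution (W : Fin n → ℝ≥0 → ℝ≥0∞) : Prop :=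
  (∀ i, Measurable (W i)) ∧ ∀ i x, W i x = p.oneStepValue W i x

/-- The phase-wise barrier strategy with barriers `b`: the minimal dividend process that keeps the
surplus below the barrier `b j` whenever the phase is `j`. The excess over the current barrier is
paid immediately, and at the barrier the incoming premium is paid. The supremum over `s < t`
(equal to `0` for `t = 0`) makes the process left-continuous. -/
def barrierStrategy (b : Fin n → ℝ≥0) (i : Fin n) (x : ℝ≥0) : DividendProcess n :=
  fun t ω => ⨆ s : Iio t, max (p.reserve i x s ω - b (phase i s ω)) 0

end RiskParams

end

noncomputable section

open Filter Topology

/-! ### The exponential law -/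

/-! The proof is renewal at the first jump. The step noises are i.i.d., so a path is a fresh step
noise followed by an independent copy of the whole path (`measurePreserving_consPath`). Before the
first jump nothing is observed, hence an admissible strategy coincides up to and including that time
with a deterministic path `d` (`IsAdmissible.exists_path`). After it the `residual` strategy is
almost surely admissible for the new phase and surplus, if there was no ruin. Thus
`IsAdmissible.payoff_eq` and `oneStepPayoff_eq` have the same integrand, except that the first
contains the payoff of the residual strategy and the second contains `W`.

Bounding the residual payoff by the value gives `value_le_oneStepValue`. The converse
`oneStepValue_le_value` needs near-optimal strategies pasted measurably after the jump. The value is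
nondecreasing in the surplus, so up to ε it is attained from below on countably many levels `s`: pay
`y - s` at once, then follow a near-optimal strategy for `s`.

Minimality and the verification of barriers come from iterating over jumps. Surplus grows at most
linearly, and half of the discounting absorbs this growth (`exp_mul_add_le`); the other half
contracts by some `r < 1`, uniformly in the phase. After `k` jumps the error is at most `r ^ k * (x
+ 2 * c / δ)`. For barriers the iteration closes because the residual of a barrier strategy is the
barrier strategy of the new state (`barrierStrategy_consPath_add`).

Two devices keep the analysis elementary. Discounting is the survival of an independent exponential
clock, so discounted dividends are an average of values of the path (`discounted_eq`).
Left-continuity reduces measurability and almost sure statements to countably many times. -/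

theorem expLaw_Ioi {r : ℝ} (hr : 0 < r) (t : ℝ≥0) :
    expLaw r (Ioi t) = ENNReal.ofReal (Real.exp (-r * t)) := by
  have := isProbabilityMeasure_expMeasure hr
  rw [expLaw, Measure.map_apply (by fun_prop) measurableSet_Ioi]
  have h : Real.toNNReal ⁻¹' Ioi t = (Iic (t : ℝ))ᶜ := by
    ext s
    simp [Real.lt_toNNReal_iff_coe_lt]
  rw [h, prob_compl_eq_one_sub measurableSet_Iic, ← ofReal_cdf, cdf_expMeasure_eq hr,
    if_pos t.coe_nonneg, ← ENNReal.ofReal_one, ← ENNReal.ofReal_sub]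
  · congr 1
    rw [neg_mul]
    ring
  · rw [sub_nonneg, Real.exp_le_one_iff]
    exact neg_nonpos.2 (mul_nonneg hr.le t.coe_nonneg)

/-- Memorylessness, tested on the π-system of half-lines. -/
theorem expLaw_restrict_map_sub {r : ℝ} (hr : 0 < r) (τ : ℝ≥0) :
    ((expLaw r).restrict (Ioi τ)).map (fun s => s - τ) =
      ENNReal.ofReal (Real.exp (-r * τ)) • expLaw r := by
  have := RiskParams.isProbabilityMeasure_expLaw hr
  have hm : Measurable fun s : ℝ≥0 => s - τ := by fun_prop
  refine ext_of_generate_finite (range Ioi)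
    ((BorelSpace.measurable_eq (α := ℝ≥0)).trans (borel_eq_generateFrom_Ioi ℝ≥0))
    isPiSystem_Ioi ?_ ?_
  · rintro _ ⟨u, rfl⟩
    rw [Measure.map_apply hm measurableSet_Ioi, Measure.restrict_apply (hm measurableSet_Ioi),
      Measure.smul_apply, expLaw_Ioi hr, smul_eq_mul,
      ← ENNReal.ofReal_mul (Real.exp_pos _).le, ← Real.exp_add]
    have : (fun s : ℝ≥0 => s - τ) ⁻¹' Ioi u ∩ Ioi τ = Ioi (τ + u) := by
      ext s
      simp only [mem_inter_iff, mem_preimage, mem_Ioi, lt_tsub_iff_left]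
      exact ⟨fun h => h.1, fun h => ⟨h, lt_of_le_of_lt le_self_add h⟩⟩
    rw [this, expLaw_Ioi hr]
    congr 2
    push_cast
    ring
  · rw [Measure.map_apply hm MeasurableSet.univ, preimage_univ, Measure.restrict_apply_univ,
      expLaw_Ioi hr, Measure.smul_apply, measure_univ, smul_eq_mul, mul_one]

theorem lintegral_expLaw_sub {r : ℝ} (hr : 0 < r) (τ : ℝ≥0) {g : ℝ≥0 → ℝ≥0∞} (hg : Measurable g) :
    ∫⁻ s in Ioi τ, g (s - τ) ∂expLaw r =
      ENNReal.ofReal (Real.exp (-r * τ)) * ∫⁻ s, g s ∂expLaw r := by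
  have hm : Measurable fun s : ℝ≥0 => s - τ := by fun_prop
  rw [← lintegral_map hg hm, expLaw_restrict_map_sub hr, lintegral_smul_measure, smul_eq_mul]

theorem lintegral_id_expLaw {r : ℝ} (hr : 0 < r) :
    ∫⁻ s : ℝ≥0, ENNReal.ofReal s ∂expLaw r = ENNReal.ofReal (1 / r) := by
  rw [lintegral_eq_lintegral_meas_lt _ (Eventually.of_forall fun s => s.coe_nonneg)
    (by fun_prop)]
  have h : ∀ t ∈ Ioi (0 : ℝ), expLaw r {a : ℝ≥0 | t < a} =
      ENNReal.ofReal (Real.exp (-r * t)) := by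
    intro t ht
    have : {a : ℝ≥0 | t < a} = Ioi t.toNNReal := by
      ext a
      simp [Real.toNNReal_lt_iff_lt_coe (le_of_lt ht)]
    rw [this, expLaw_Ioi hr, Real.coe_toNNReal t (le_of_lt ht)]
  rw [setLIntegral_congr_fun measurableSet_Ioi h, ← ofReal_integral_eq_lintegral_ofReal
    (exp_neg_integrableOn_Ioi 0 hr) (Eventually.of_forall fun _ => (Real.exp_pos _).le),
    integral_exp_mul_Ioi (neg_lt_zero.2 hr)]
  simp

theorem expLaw_pos_ae {r : ℝ} (hr : 0 < r) : ∀ᵐ s ∂expLaw r, 0 < s := by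
  have := RiskParams.isProbabilityMeasure_expLaw hr
  have h : expLaw r (Ioi 0) = 1 := by rw [expLaw_Ioi hr]; simp
  exact (prob_compl_eq_zero_iff measurableSet_Ioi).2 h

/-- Strictness, which comes from `s > 0` almost surely, is what makes the iteration over jumps
contract. -/
theorem lintegral_exp_expLaw_lt_one {r θ : ℝ} (hr : 0 < r) (hθ : 0 < θ) :
    ∫⁻ s : ℝ≥0, ENNReal.ofReal (Real.exp (-θ * s)) ∂expLaw r < 1 := by
  have := RiskParams.isProbabilityMeasure_expLaw hr
  have hle : ∀ s : ℝ≥0, ENNReal.ofReal (Real.exp (-θ * s)) ≤ 1 := fun s => by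
    rw [← ENNReal.ofReal_one]
    refine ENNReal.ofReal_le_ofReal (Real.exp_le_one_iff.2 ?_)
    rw [neg_mul]
    exact neg_nonpos.2 (mul_nonneg hθ.le s.coe_nonneg)
  have hfin : ∫⁻ s : ℝ≥0, ENNReal.ofReal (Real.exp (-θ * s)) ∂expLaw r ≠ ∞ := by
    refine ne_top_of_le_ne_top ENNReal.one_ne_top ((lintegral_mono hle).trans ?_)
    simp
  have h := lintegral_strict_mono (μ := expLaw r) (IsProbabilityMeasure.ne_zero _)
    (g := fun _ => (1 : ℝ≥0∞)) aemeasurable_const hfin ?_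
  · simpa using h
  · filter_upwards [expLaw_pos_ae hr] with s hs
    rw [← ENNReal.ofReal_one, ENNReal.ofReal_lt_ofReal_iff one_pos, Real.exp_lt_one_iff, neg_mul]
    exact neg_lt_zero.2 (mul_pos hθ (by exact_mod_cast hs))

/-! ### Paths of dividend processes -/

/-- Nondecreasing left-continuous functions on `[0, ∞)` that start at `0`. -/
structure IsDividendPath (d : ℝ≥0 → ℝ) : Prop where
  mono : Monotone d
  leftCont : ∀ t, ContinuousWithinAt d (Iic t) t
  zero : d 0 = 0

/-- The time `s` stopped at the possibly infinite time `T`. -/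
def stopAt (T : ℝ≥0∞) (s : ℝ≥0) : ℝ≥0 := (min (s : ℝ≥0∞) T).toNNReal

@[simp]
theorem stopAt_top (s : ℝ≥0) : stopAt ⊤ s = s := by simp [stopAt]

@[simp]
theorem stopAt_coe (T s : ℝ≥0) : stopAt T s = min s T := by
  rw [stopAt, ← ENNReal.coe_min, ENNReal.toNNReal_coe]

theorem stopAt_le (T : ℝ≥0∞) (s : ℝ≥0) : stopAt T s ≤ s := by
  induction T using ENNReal.recTopCoe with
  | top => simp
  | coe T => simp

theorem coe_stopAt (T : ℝ≥0∞) (s : ℝ≥0) : (stopAt T s : ℝ≥0∞) = min (s : ℝ≥0∞) T := by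
  rw [stopAt, ENNReal.coe_toNNReal]
  exact ne_top_of_le_ne_top ENNReal.coe_ne_top (min_le_left _ _)

theorem measurable_stopAt : Measurable fun q : ℝ≥0∞ × ℝ≥0 => stopAt q.1 q.2 :=
  (measurable_snd.coe_nnreal_ennreal.min measurable_fst).ennreal_toNNReal

theorem stopAt_add {τ s : ℝ≥0} (h : τ < s) (T : ℝ≥0∞) :
    stopAt (τ + T) s = τ + stopAt T (s - τ) := by
  induction T using ENNReal.recTopCoe with
  | top => simp [add_tsub_cancel_of_le h.le]
  | coe T =>
    rw [← ENNReal.coe_add, stopAt_coe, stopAt_coe, ← min_add_add_left,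
      add_tsub_cancel_of_le h.le]

theorem stopAt_add_of_le {τ s : ℝ≥0} (h : s ≤ τ) (T : ℝ≥0∞) :
    stopAt (τ + T) s = s := by
  rw [← ENNReal.coe_inj, coe_stopAt, min_eq_left]
  exact (ENNReal.coe_le_coe.2 h).trans le_self_add

namespace IsDividendPath

variable {d : ℝ≥0 → ℝ} (hd : IsDividendPath d)
include hd

theorem measurable : Measurable d := hd.mono.measurable

theorem nonneg (t : ℝ≥0) : 0 ≤ d t := hd.zero ▸ hd.mono (zero_le (a := t))

theorem mono_real : Monotone fun t : ℝ => d t.toNNReal :=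
  fun _ _ h => hd.mono (Real.toNNReal_mono h)

theorem leftCont_real (b : ℝ) : Tendsto (fun t : ℝ => d t.toNNReal) (𝓝[<] b)
    (𝓝 (d b.toNNReal)) :=
  Tendsto.comp (hd.leftCont b.toNNReal)
    (tendsto_nhdsWithin_of_tendsto_nhds_of_eventually_within _
      ((continuous_real_toNNReal.tendsto b).mono_left nhdsWithin_le_nhds)
      (eventually_nhdsWithin_of_forall fun _ ht => Real.toNNReal_mono (le_of_lt ht)))

/-- The Stieltjes function is the right-continuous modification of `d`; its left limits give back
the left-continuous `d`, so `[0, b)` has mass `d b` without boundary corrections. -/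
theorem leftLim_stieltjesFunction (b : ℝ) :
    Function.leftLim hd.mono_real.stieltjesFunction b = d b.toNNReal := by
  apply leftLim_eq_of_tendsto
  refine tendsto_of_tendsto_of_tendsto_of_le_of_le' (hd.leftCont_real b) tendsto_const_nhds ?_ ?_
  · refine Eventually.of_forall fun t => ?_
    rw [hd.mono_real.stieltjesFunction_eq]
    exact hd.mono_real.le_rightLim le_rfl
  · refine eventually_nhdsWithin_of_forall fun t ht => ?_
    rw [hd.mono_real.stieltjesFunction_eq]
    exact hd.mono_real.rightLim_le ht

theorem dividendMeasure_eq : dividendMeasure d = hd.mono_real.stieltjesFunction.measure := by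
  rw [dividendMeasure, dif_pos hd.mono_real]

theorem dividendMeasure_Ico (b : ℝ) :
    dividendMeasure d (Ico 0 b) = ENNReal.ofReal (d b.toNNReal) := by
  rw [hd.dividendMeasure_eq, StieltjesFunction.measure_Ico, hd.leftLim_stieltjesFunction,
    hd.leftLim_stieltjesFunction, Real.toNNReal_zero, hd.zero, sub_zero]

end IsDividendPath

/-- `exp (-δ t)` is the probability that an exponential clock with rate `δ` rings after `t`. By
Tonelli the Stieltjes integral becomes the mean of the dividends paid until the clock rings or `T`
is reached. -/
theorem RiskParams.discounted_eq {n : ℕ} (p : RiskParams n) {d : ℝ≥0 → ℝ} (hd : IsDividendPath d)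
    (T : ℝ≥0∞) : p.discounted {t | 0 ≤ t ∧ ENNReal.ofReal t < T} d =
      ∫⁻ s, ENNReal.ofReal (d (stopAt T s)) ∂expLaw p.δ := by
  have := RiskParams.isProbabilityMeasure_expLaw p.δ_pos
  have hA : MeasurableSet {t : ℝ | 0 ≤ t ∧ ENNReal.ofReal t < T} :=
    measurableSet_Ici.inter (measurableSet_lt ENNReal.measurable_ofReal measurable_const)
  have : SFinite (dividendMeasure d) := by
    rw [hd.dividendMeasure_eq]
    infer_instance
  have h1 : ∀ t ∈ {t : ℝ | 0 ≤ t ∧ ENNReal.ofReal t < T},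
      ENNReal.ofReal (Real.exp (-p.δ * t)) =
        ∫⁻ s : ℝ≥0, {q : ℝ × ℝ≥0 | q.1 < q.2}.indicator 1 (t, s) ∂expLaw p.δ := by
    intro t ht
    have : (fun s : ℝ≥0 => {q : ℝ × ℝ≥0 | q.1 < q.2}.indicator (1 : ℝ × ℝ≥0 → ℝ≥0∞) (t, s)) =
        (Ioi t.toNNReal).indicator 1 := by
      ext s
      simp only [indicator, mem_ofPred_eq, mem_Ioi, Real.toNNReal_lt_iff_lt_coe ht.1]
      rfl
    rw [this, lintegral_indicator_one measurableSet_Ioi, expLaw_Ioi p.δ_pos,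
      Real.coe_toNNReal t ht.1]
  rw [discounted, setLIntegral_congr_fun hA h1, lintegral_lintegral_swap]
  · refine lintegral_congr fun s => ?_
    have h2 : (fun t : ℝ => {q : ℝ × ℝ≥0 | q.1 < q.2}.indicator (1 : ℝ × ℝ≥0 → ℝ≥0∞) (t, s)) =
        (Iio (s : ℝ)).indicator 1 := by
      ext t
      simp only [indicator, mem_ofPred_eq, mem_Iio]
      rfl
    have h3 : Iio (s : ℝ) ∩ {t | 0 ≤ t ∧ ENNReal.ofReal t < T} = Ico 0 (stopAt T s : ℝ) := by
      ext t
      simp only [mem_inter_iff, mem_Iio, mem_ofPred_eq, mem_Ico]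
      have : 0 ≤ t → (t < stopAt T s ↔ t < s ∧ ENNReal.ofReal t < T) := by
        intro ht
        lift t to ℝ≥0 using ht
        rw [NNReal.coe_lt_coe, ← ENNReal.coe_lt_coe, coe_stopAt, lt_min_iff,
          ENNReal.ofReal_coe_nnreal, ENNReal.coe_lt_coe, NNReal.coe_lt_coe]
      tauto
    rw [h2, lintegral_indicator_one measurableSet_Iio, Measure.restrict_apply measurableSet_Iio,
      h3, hd.dividendMeasure_Ico, Real.toNNReal_coe]
  · refine Measurable.aemeasurable ?_
    exact measurable_one.indicator (measurableSet_lt measurable_fst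
      (measurable_snd.coe_nnreal_real))

theorem RiskParams.discounted_Ico {n : ℕ} (p : RiskParams n) {d : ℝ≥0 → ℝ} (hd : IsDividendPath d)
    (τ : ℝ≥0) : p.discounted (Ico 0 (τ : ℝ)) d =
      ∫⁻ s, ENNReal.ofReal (d (min s τ)) ∂expLaw p.δ := by
  have h := p.discounted_eq hd τ
  simp only [stopAt_coe] at h
  rw [← h]
  congr 1
  ext t
  refine and_congr_right fun ht => ?_
  lift t to ℝ≥0 using ht
  rw [ENNReal.ofReal_coe_nnreal, ENNReal.coe_lt_coe, NNReal.coe_lt_coe]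

theorem IsDividendPath.shift {d : ℝ≥0 → ℝ} (hd : IsDividendPath d) (τ : ℝ≥0) :
    IsDividendPath fun t => d (τ + t) - d τ where
  mono _ _ h := sub_le_sub_right (hd.mono (add_le_add_right h τ)) _
  leftCont t := by
    refine ContinuousWithinAt.sub ?_ continuousWithinAt_const
    refine (hd.leftCont (τ + t)).comp (by fun_prop) fun s hs => ?_
    exact add_le_add_right (mem_Iic.1 hs) _
  zero := by simp

/-- A clock that survives `τ` starts afresh there; one that rings by `τ` contributes to the first
term only. -/
theorem RiskParams.discounted_add {n : ℕ} (p : RiskParams n) {d : ℝ≥0 → ℝ} (hd : IsDividendPath d)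
    (τ : ℝ≥0) (T : ℝ≥0∞) :
    p.discounted {t | 0 ≤ t ∧ ENNReal.ofReal t < τ + T} d =
      p.discounted (Ico 0 (τ : ℝ)) d + ENNReal.ofReal (Real.exp (-p.δ * τ)) *
        p.discounted {t | 0 ≤ t ∧ ENNReal.ofReal t < T} fun t => d (τ + t) - d τ := by
  have hs := hd.shift τ
  rw [p.discounted_eq hd, p.discounted_Ico hd, p.discounted_eq hs,
    ← lintegral_expLaw_sub p.δ_pos τ, ← lintegral_indicator measurableSet_Ioi,
    ← lintegral_add_left]
  · refine lintegral_congr fun s => ?_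
    by_cases h : τ < s
    · rw [indicator_of_mem (mem_Ioi.2 h), stopAt_add h, min_eq_right h.le, ← ENNReal.ofReal_add
        (hd.nonneg _) (hs.nonneg _)]
      congr 1
      ring
    · rw [indicator_of_notMem (by simpa using h), stopAt_add_of_le (not_lt.1 h),
        min_eq_left (not_lt.1 h), add_zero]
  · exact (hd.measurable.comp (by fun_prop)).ennreal_ofReal
  · have h1 : Measurable (stopAt T) := measurable_stopAt.comp measurable_prodMk_left
    exact ((hd.measurable.comp (measurable_const.add h1)).sub_const _).ennreal_ofReal

theorem RiskParams.discounted_le {n : ℕ} (p : RiskParams n) {d : ℝ≥0 → ℝ} (hd : IsDividendPath d)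
    {T : ℝ≥0∞} {x : ℝ≥0} (h : ∀ t : ℝ≥0, (t : ℝ≥0∞) < T → d t ≤ x + p.c * t) :
    p.discounted {t | 0 ≤ t ∧ ENNReal.ofReal t < T} d ≤ ENNReal.ofReal (x + p.c / p.δ) := by
  have := RiskParams.isProbabilityMeasure_expLaw p.δ_pos
  have hc := p.c_pos
  have hδ := p.δ_pos
  -- A clock ringing after `T` evaluates `d` at `T` itself; left-continuity carries the bound to
  -- this endpoint.
  have h' : ∀ t : ℝ≥0, (t : ℝ≥0∞) ≤ T → d t ≤ x + p.c * t := by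
    intro t ht
    rcases eq_or_lt_of_le (zero_le (a := t)) with h0 | h0
    · rw [← h0, hd.zero]
      positivity
    · have : (𝓝[<] t).NeBot := nhdsLT_neBot_of_exists_lt ⟨0, h0⟩
      refine le_of_tendsto_of_tendsto ((hd.leftCont t).mono Iio_subset_Iic_self)
        (g := fun t : ℝ≥0 => (x : ℝ) + p.c * t) ?_ ?_
      · exact Tendsto.mono_left (Continuous.tendsto (by fun_prop) t) nhdsWithin_le_nhds
      · exact eventually_nhdsWithin_of_forall fun s hs =>
          h s ((ENNReal.coe_lt_coe.2 hs).trans_le ht)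
  calc p.discounted {t | 0 ≤ t ∧ ENNReal.ofReal t < T} d
      = ∫⁻ s, ENNReal.ofReal (d (stopAt T s)) ∂expLaw p.δ := p.discounted_eq hd T
    _ ≤ ∫⁻ s : ℝ≥0, (ENNReal.ofReal x + ENNReal.ofReal p.c * ENNReal.ofReal s) ∂expLaw p.δ := by
        refine lintegral_mono fun s => ?_
        rw [← ENNReal.ofReal_mul hc.le, ← ENNReal.ofReal_add x.coe_nonneg (by positivity)]
        refine ENNReal.ofReal_le_ofReal ((h' _ ?_).trans ?_)
        · rw [coe_stopAt]
          exact min_le_right _ _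
        · have : (stopAt T s : ℝ) ≤ s := by exact_mod_cast stopAt_le T s
          gcongr
    _ = ENNReal.ofReal (x + p.c / p.δ) := by
        rw [lintegral_add_left measurable_const, lintegral_const_mul' _ _ ENNReal.ofReal_ne_top,
          lintegral_id_expLaw p.δ_pos, lintegral_const, measure_univ, mul_one,
          ← ENNReal.ofReal_mul hc.le, ← ENNReal.ofReal_add x.coe_nonneg (by positivity)]
        congr 1
        ring

namespace RiskParams

variable {n : ℕ} (p : RiskParams n)

/-! ### Splitting off the first sojourn -/

/-- The path that starts with the step noise `a` and continues with `ω`. -/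
def consPath (a : StepNoise n) (ω : PathSpace n) : PathSpace n
  | 0 => a
  | k + 1 => ω k

/-- The path without its first step noise. -/
def shiftPath (ω : PathSpace n) : PathSpace n := fun k => ω (k + 1)

@[simp]
theorem shiftPath_consPath (a : StepNoise n) (ω : PathSpace n) : shiftPath (consPath a ω) = ω := rfl

theorem consPath_shiftPath (ω : PathSpace n) : consPath (ω 0) (shiftPath ω) = ω := by
  ext1 k
  cases k <;> rfl

theorem measurable_consPath :
    Measurable fun q : StepNoise n × PathSpace n => consPath q.1 q.2 := by
  refine measurable_pi_lambda _ fun k => ?_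
  cases k with
  | zero => exact measurable_fst
  | succ k => exact (measurable_pi_apply k).comp measurable_snd

theorem measurable_shiftPath : Measurable (shiftPath : PathSpace n → PathSpace n) :=
  measurable_pi_lambda _ fun k => measurable_pi_apply (k + 1)

/-- The renewal structure, checked on finite cylinders by separating coordinate `0` from the others.
-/
theorem measurePreserving_consPath :
    MeasurePreserving (fun q : StepNoise n × PathSpace n => consPath q.1 q.2)
      (p.stepLaw.prod p.P) p.P := by
  refine ⟨measurable_consPath, ?_⟩
  classical
  refine Measure.eq_infinitePi (fun _ => p.stepLaw) fun s t ht => ?_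
  have hs : MeasurableSet ((s : Set ℕ).pi t) := MeasurableSet.pi s.countable_toSet fun i _ => ht i
  -- The positive indices of `s`, lowered by one.
  set s' : Finset ℕ := s.preimage Nat.succ (Nat.succ_injective.injOn)
  have hpre : (fun q : StepNoise n × PathSpace n => consPath q.1 q.2) ⁻¹' ((s : Set ℕ).pi t) =
      (if 0 ∈ s then t 0 else univ) ×ˢ ((s' : Set ℕ).pi fun k => t (k + 1)) := by
    ext q
    simp only [mem_preimage, Set.mem_pi, Finset.mem_coe, mem_prod, s', Finset.mem_preimage]
    constructor
    · intro h
      refine ⟨?_, fun k hk => h (k + 1) hk⟩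
      split_ifs with h0
      · exact h 0 h0
      · trivial
    · rintro ⟨h1, h2⟩ k hk
      cases k with
      | zero => rwa [if_pos hk] at h1
      | succ k => exact h2 k hk
  have hprod : ∏ i ∈ s, p.stepLaw (t i) = (if 0 ∈ s then p.stepLaw (t 0) else 1) *
      ∏ k ∈ s', p.stepLaw (t (k + 1)) := by
    have h1 : ∏ k ∈ s', p.stepLaw (t (k + 1)) =
        ∏ i ∈ s with i ∈ range Nat.succ, p.stepLaw (t i) :=
      Finset.prod_preimage' Nat.succ s Nat.succ_injective.injOn fun i => p.stepLaw (t i)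
    have h2 : ∏ i ∈ s with ¬ i ∈ range Nat.succ, p.stepLaw (t i) =
        if 0 ∈ s then p.stepLaw (t 0) else 1 := by
      have : s.filter (fun i => ¬ i ∈ range Nat.succ) = if 0 ∈ s then {0} else ∅ := by
        ext i
        cases i with
        | zero => split_ifs with h <;> simp [h]
        | succ k => split_ifs with h <;> simp
      rw [this]
      split_ifs <;> simp
    rw [h1, ← h2, mul_comm, Finset.prod_filter_mul_prod_filter_not]
  rw [Measure.map_apply measurable_consPath hs, hpre, Measure.prod_prod, hprod, P,
    Measure.infinitePi_pi _ fun i _ => ht (i + 1)]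
  congr 1
  split_ifs <;> simp

/-- Almost everywhere measurability is assumed because strategies are measurable only for completed
σ-algebras. -/
theorem lintegral_P {F : PathSpace n → ℝ≥0∞} (hF : AEMeasurable F p.P) :
    ∫⁻ ω, F ω ∂p.P = ∫⁻ a, ∫⁻ ω, F (consPath a ω) ∂p.P ∂p.stepLaw := by
  have h := p.measurePreserving_consPath
  rw [← h.map_eq] at hF
  have h1 := lintegral_map' hF h.aemeasurable
  rw [h.map_eq] at h1
  exact h1.trans (lintegral_prod _ (hF.comp_aemeasurable h.aemeasurable))

theorem ae_ae_consPath {Q : PathSpace n → Prop} (hQ : ∀ᵐ ω ∂p.P, Q ω) :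
    ∀ᵐ a ∂p.stepLaw, ∀ᵐ ω ∂p.P, Q (consPath a ω) :=
  Measure.ae_ae_of_ae_prod (p.measurePreserving_consPath.quasiMeasurePreserving.ae hQ)

theorem measurePreserving_shiftPath : MeasurePreserving (shiftPath : PathSpace n → _) p.P p.P := by
  refine ⟨measurable_shiftPath, ?_⟩
  have h := p.measurePreserving_consPath
  conv_lhs => rw [← h.map_eq]
  rw [Measure.map_map measurable_shiftPath measurable_consPath]
  exact (measurePreserving_snd (μ := p.stepLaw) (ν := p.P)).map_eq

theorem ae_shiftPath {Q : PathSpace n → Prop} (hQ : ∀ᵐ ω ∂p.P, Q ω) :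
    ∀ᵐ ω ∂p.P, Q (shiftPath ω) :=
  p.measurePreserving_shiftPath.quasiMeasurePreserving.ae hQ

theorem ae_step {Q : StepNoise n → Prop} (hQ : ∀ᵐ a ∂p.stepLaw, Q a) (k : ℕ) :
    ∀ᵐ ω ∂p.P, Q (ω k) :=
  (measurePreserving_eval_infinitePi (fun _ : ℕ => p.stepLaw) k).quasiMeasurePreserving.ae hQ

theorem measurePreserving_holdMark (i : Fin n) :
    MeasurePreserving (fun a : StepNoise n => a.1 i) p.stepLaw
      ((expLaw (p.rate i)).prod (discreteLaw (p.jumpProb i))) := by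
  have h1 := fun i => isProbabilityMeasure_expLaw (p.rate_pos i)
  have h2 := fun i => isProbabilityMeasure_discreteLaw (p.jumpProb_nonneg i) (p.jumpProb_sum i)
  have h3 := isProbabilityMeasure_discreteLaw p.init_nonneg p.init_sum
  have h4 := isProbabilityMeasure_expLaw p.β_pos
  exact (measurePreserving_eval (fun i => (expLaw (p.rate i)).prod (discreteLaw (p.jumpProb i)))
    i).comp measurePreserving_fst

theorem measurePreserving_hold (i : Fin n) :
    MeasurePreserving (fun a : StepNoise n => (a.1 i).1) p.stepLaw (expLaw (p.rate i)) := by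
  have h2 := isProbabilityMeasure_discreteLaw (p.jumpProb_nonneg i) (p.jumpProb_sum i)
  exact measurePreserving_fst.comp (p.measurePreserving_holdMark i)

theorem measurePreserving_mark (i : Fin n) :
    MeasurePreserving (fun a : StepNoise n => (a.1 i).2) p.stepLaw
      (discreteLaw (p.jumpProb i)) := by
  have h1 := isProbabilityMeasure_expLaw (p.rate_pos i)
  have h2 := isProbabilityMeasure_discreteLaw (p.jumpProb_nonneg i) (p.jumpProb_sum i)
  exact measurePreserving_snd.comp (p.measurePreserving_holdMark i)

theorem lintegral_discreteLaw {α : Type*} [Fintype α] [MeasurableSpace α]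
    [MeasurableSingletonClass α] (w : α → ℝ) (f : α → ℝ≥0∞) :
    ∫⁻ a, f a ∂discreteLaw w = ∑ a, ENNReal.ofReal (w a) * f a := by
  simp [discreteLaw, lintegral_finsetSum_measure]

/-- A jump that is not a claim really changes the phase, so every jump is visible in the observed
process. -/
theorem mark_ne_ae (i : Fin n) : ∀ᵐ a ∂p.stepLaw, (a.1 i).2 ≠ i.castSucc := by
  refine (p.measurePreserving_mark i).quasiMeasurePreserving.ae (p := fun e => e ≠ i.castSucc) ?_
  rw [ae_iff, ← lintegral_indicator_one (Set.to_countable _).measurableSet, lintegral_discreteLaw]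
  refine Finset.sum_eq_zero fun e _ => ?_
  by_cases he : e = i.castSucc
  · subst he
    simp [jumpProb]
  · simp [he]

theorem hold_pos_ae (i : Fin n) : ∀ᵐ a ∂p.stepLaw, 0 < (a.1 i).1 :=
  (p.measurePreserving_hold i).quasiMeasurePreserving.ae (expLaw_pos_ae (p.rate_pos i))

/-- There are finitely many phases, so one contraction factor serves them all. -/
theorem exists_lintegral_exp_hold_le {θ : ℝ} (hθ : 0 < θ) : ∃ r : ℝ≥0∞, r < 1 ∧ ∀ i,
    ∫⁻ a : StepNoise n, ENNReal.ofReal (Real.exp (-θ * (a.1 i).1)) ∂p.stepLaw ≤ r := by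
  have h : ∀ i, ∫⁻ a : StepNoise n, ENNReal.ofReal (Real.exp (-θ * (a.1 i).1)) ∂p.stepLaw < 1 := by
    intro i
    refine lt_of_eq_of_lt ?_ (lintegral_exp_expLaw_lt_one (p.rate_pos i) hθ)
    exact (p.measurePreserving_hold i).lintegral_comp
      (f := fun s : ℝ≥0 => ENNReal.ofReal (Real.exp (-θ * s))) (by fun_prop)
  refine ⟨Finset.univ.sup fun i =>
    ∫⁻ a : StepNoise n, ENNReal.ofReal (Real.exp (-θ * (a.1 i).1)) ∂p.stepLaw, ?_, ?_⟩
  · exact (Finset.sup_lt_iff one_pos).2 fun i _ => h i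
  · exact fun i => Finset.le_sup (f := fun i =>
      ∫⁻ a : StepNoise n, ENNReal.ofReal (Real.exp (-θ * (a.1 i).1)) ∂p.stepLaw)
      (Finset.mem_univ i)

/-- The phase after the first jump, if the first step noise is `a`. -/
def nextPhase (i : Fin n) (a : StepNoise n) : Fin n :=
  Fin.lastCases (motive := fun _ => Fin n) a.2.1 (fun j => j) (a.1 i).2

/-- The claim at the first jump (`0` if the jump is not a claim), if the first step noise is `a`. -/
def firstClaim (i : Fin n) (a : StepNoise n) : ℝ :=
  if (a.1 i).2 = Fin.last n then (a.2.2 : ℝ) else 0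

section cons

variable (i : Fin n) (a : StepNoise n) (ω : PathSpace n)

theorem phaseAt_consPath_succ (k : ℕ) :
    phaseAt i (consPath a ω) (k + 1) = phaseAt (nextPhase i a) ω k := by
  induction k with
  | zero => rfl
  | succ k ih =>
    rw [phaseAt, ih]
    rfl

theorem hold_consPath_zero : hold i (consPath a ω) 0 = (a.1 i).1 := rfl

theorem hold_consPath_succ (k : ℕ) :
    hold i (consPath a ω) (k + 1) = hold (nextPhase i a) ω k := by
  rw [hold, phaseAt_consPath_succ]
  rfl

theorem entered_consPath_succ (k : ℕ) :
    entered i (consPath a ω) (k + 1) = entered (nextPhase i a) ω k := by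
  rw [entered, phaseAt_consPath_succ]
  rfl

theorem jumpTime_consPath_succ (k : ℕ) :
    jumpTime i (consPath a ω) (k + 1) = (a.1 i).1 + jumpTime (nextPhase i a) ω k := by
  rw [jumpTime, Finset.sum_range_succ', add_comm]
  simp_rw [hold_consPath_succ]
  rfl

end cons

theorem jumpTime_one (i : Fin n) (ω : PathSpace n) : jumpTime i ω 1 = hold i ω 0 := by
  simp [jumpTime]

theorem hold_zero_le_jumpTime (i : Fin n) (ω : PathSpace n) (k : ℕ) :
    hold i ω 0 ≤ jumpTime i ω (k + 1) := by
  rw [jumpTime, Finset.sum_range_succ']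
  exact le_add_self

/-! ### Behaviour of the observed processes -/

/-- The observed process: the phase, the number of claims and the sum of the claims. -/
def observed (i : Fin n) (t : ℝ≥0) (ω : PathSpace n) : Fin n × ℕ × ℝ :=
  (phase i t ω, claimCount i t ω, aggregateClaims i t ω)

theorem jumpCount_of_lt {i : Fin n} {t : ℝ≥0} {ω : PathSpace n} (h : t < hold i ω 0) :
    jumpCount i t ω = 0 :=
  Nat.sInf_eq_zero.2 (Or.inl (by simpa [jumpTime_one] using h))

theorem observed_of_lt {i : Fin n} {t : ℝ≥0} {ω : PathSpace n} (h : t < hold i ω 0) :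
    observed i t ω = (i, 0, 0) := by
  simp [observed, phase, claimCount, aggregateClaims, jumpCount_of_lt h, phaseAt]

theorem aggregateClaims_of_lt {i : Fin n} {t : ℝ≥0} {ω : PathSpace n} (h : t < hold i ω 0) :
    aggregateClaims i t ω = 0 := congrArg (fun q => q.2.2) (observed_of_lt h)

theorem aggregateClaims_nonneg (i : Fin n) (t : ℝ≥0) (ω : PathSpace n) :
    0 ≤ aggregateClaims i t ω :=
  Finset.sum_nonneg fun k _ => by split_ifs <;> positivity

/-- There are only finitely many jumps in bounded time, for every initial phase. -/
def IsNonexplosive (ω : PathSpace n) : Prop := ∀ i t, ∃ k, t < jumpTime i ω (k + 1)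

section nonexplosive

variable {ω : PathSpace n} (hω : IsNonexplosive ω)
include hω

theorem lt_jumpTime_jumpCount (i : Fin n) (t : ℝ≥0) :
    t < jumpTime i ω (jumpCount i t ω + 1) :=
  Nat.sInf_mem (s := {k | t < jumpTime i ω (k + 1)}) (hω i t)

theorem jumpCount_mono (i : Fin n) {s t : ℝ≥0} (h : s ≤ t) :
    jumpCount i s ω ≤ jumpCount i t ω :=
  Nat.sInf_le (s := {k | s < jumpTime i ω (k + 1)})
    (h.trans_lt (lt_jumpTime_jumpCount hω i t))

theorem jumpCount_eventuallyEq (i : Fin n) (t : ℝ≥0) :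
    ∀ᶠ s in 𝓝[≥] t, jumpCount i s ω = jumpCount i t ω := by
  filter_upwards [Ico_mem_nhdsGE (lt_jumpTime_jumpCount hω i t)] with s hs
  exact le_antisymm (Nat.sInf_le hs.2) (jumpCount_mono hω i hs.1)

theorem observed_eventuallyEq (i : Fin n) (t : ℝ≥0) :
    ∀ᶠ s in 𝓝[≥] t, observed i s ω = observed i t ω := by
  filter_upwards [jumpCount_eventuallyEq hω i t] with s hs
  simp [observed, phase, claimCount, aggregateClaims, hs]

theorem aggregateClaims_mono (i : Fin n) {s t : ℝ≥0} (h : s ≤ t) :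
    aggregateClaims i s ω ≤ aggregateClaims i t ω :=
  Finset.sum_le_sum_of_subset_of_nonneg (Finset.range_mono (jumpCount_mono hω i h))
    fun k _ _ => by split_ifs <;> positivity

/-- Nonexplosion matters: if no jump time exceeded `t`, both counts would be the default `sInf ∅ =
0` and the shift by one would fail. -/
theorem jumpCount_consPath_add (i : Fin n) (a : StepNoise n) (t : ℝ≥0) :
    jumpCount i ((a.1 i).1 + t) (consPath a ω) = jumpCount (nextPhase i a) t ω + 1 := by
  have h : ∀ k, (a.1 i).1 + t < jumpTime i (consPath a ω) (k + 1) ↔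
      t < jumpTime (nextPhase i a) ω k := fun k => by
    rw [jumpTime_consPath_succ, add_lt_add_iff_left]
  refine le_antisymm (Nat.sInf_le ((h _).2 (lt_jumpTime_jumpCount hω _ t))) ?_
  have hne : {k | (a.1 i).1 + t < jumpTime i (consPath a ω) (k + 1)}.Nonempty :=
    ⟨_, (h _).2 (lt_jumpTime_jumpCount hω _ t)⟩
  have hmem := Nat.sInf_mem hne
  change jumpCount _ t ω + 1 ≤ sInf {k | (a.1 i).1 + t < jumpTime i (consPath a ω) (k + 1)}
  obtain ⟨m, hm⟩ : ∃ m, sInf {k | (a.1 i).1 + t < jumpTime i (consPath a ω) (k + 1)} = m := ⟨_, rfl⟩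
  rw [hm] at hmem ⊢
  have h1 := (h m).1 hmem
  cases m with
  | zero => simp [jumpTime] at h1
  | succ m => exact Nat.succ_le_succ (Nat.sInf_le h1)

theorem phase_consPath_add (i : Fin n) (a : StepNoise n) (t : ℝ≥0) :
    phase i ((a.1 i).1 + t) (consPath a ω) = phase (nextPhase i a) t ω := by
  rw [phase, jumpCount_consPath_add hω, phaseAt_consPath_succ]
  rfl

theorem claimCount_consPath_add (i : Fin n) (a : StepNoise n) (t : ℝ≥0) :
    claimCount i ((a.1 i).1 + t) (consPath a ω) =
      (if (a.1 i).2 = Fin.last n then 1 else 0) + claimCount (nextPhase i a) t ω := by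
  rw [claimCount, jumpCount_consPath_add hω, Finset.sum_range_succ', add_comm]
  simp_rw [entered_consPath_succ]
  rfl

theorem aggregateClaims_consPath_add (i : Fin n) (a : StepNoise n) (t : ℝ≥0) :
    aggregateClaims i ((a.1 i).1 + t) (consPath a ω) =
      firstClaim i a + aggregateClaims (nextPhase i a) t ω := by
  rw [aggregateClaims, jumpCount_consPath_add hω, Finset.sum_range_succ', add_comm]
  simp_rw [entered_consPath_succ]
  rfl

end nonexplosive

/-! ### Nonexplosion of the jump times -/

theorem exists_lintegral_exp_jumpTime_le : ∃ r : ℝ≥0∞, r < 1 ∧ ∀ (k : ℕ) (i : Fin n),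
    ∫⁻ ω, ENNReal.ofReal (Real.exp (-jumpTime i ω k)) ∂p.P ≤ r ^ k := by
  obtain ⟨r, hr, h⟩ := p.exists_lintegral_exp_hold_le one_pos
  refine ⟨r, hr, fun k => ?_⟩
  induction k with
  | zero => simp [jumpTime]
  | succ k ih =>
    intro i
    have hm : Measurable fun ω : PathSpace n =>
        ENNReal.ofReal (Real.exp (-jumpTime i ω (k + 1))) := by
      have := measurable_jumpTime (n := n) i (k + 1)
      fun_prop
    rw [p.lintegral_P hm.aemeasurable, pow_succ']
    calc _ ≤ ∫⁻ a : StepNoise n, ENNReal.ofReal (Real.exp (-1 * (a.1 i).1)) * r ^ k ∂p.stepLaw := by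
          refine lintegral_mono fun a => ?_
          have : ∀ ω : PathSpace n,
              ENNReal.ofReal (Real.exp (-jumpTime i (consPath a ω) (k + 1))) =
                ENNReal.ofReal (Real.exp (-1 * (a.1 i).1)) *
                  ENNReal.ofReal (Real.exp (-jumpTime (nextPhase i a) ω k)) := by
            intro ω
            rw [jumpTime_consPath_succ, ← ENNReal.ofReal_mul (Real.exp_pos _).le, ← Real.exp_add]
            congr 2
            push_cast
            ring
          simp_rw [this]
          rw [lintegral_const_mul' _ _ ENNReal.ofReal_ne_top]
          gcongr
          exact ih _
      _ ≤ r * r ^ k := by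
          rw [lintegral_mul_const' _ _ (ENNReal.pow_ne_top hr.ne_top)]
          gcongr
          exact h i

/-- The mean of `exp (-jumpTime)` decays geometrically in the number of jumps, so the infimum over
the jumps vanishes almost surely and the jump times are unbounded. -/
theorem ae_isNonexplosive : ∀ᵐ ω ∂p.P, IsNonexplosive ω := by
  obtain ⟨r, hr, h⟩ := p.exists_lintegral_exp_jumpTime_le
  refine ae_all_iff.2 fun i => ?_
  have hm : ∀ k, Measurable fun ω : PathSpace n =>
      ENNReal.ofReal (Real.exp (-jumpTime i ω (k + 1))) := fun k => by
    have := measurable_jumpTime (n := n) i (k + 1)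
    fun_prop
  have h0 : ∫⁻ ω, ⨅ k, ENNReal.ofReal (Real.exp (-jumpTime i ω (k + 1))) ∂p.P = 0 := by
    refine le_antisymm ?_ bot_le
    have ht : Tendsto (fun k : ℕ => r ^ (k + 1)) atTop (𝓝 0) :=
      (ENNReal.tendsto_pow_atTop_nhds_zero_of_lt_one hr).comp (tendsto_add_atTop_nat 1)
    exact ge_of_tendsto' ht fun k => (lintegral_mono fun ω => iInf_le _ k).trans (h _ i)
  rw [lintegral_eq_zero_iff (Measurable.iInf hm)] at h0
  filter_upwards [h0] with ω hω t
  have : ⨅ k, ENNReal.ofReal (Real.exp (-jumpTime i ω (k + 1))) <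
      ENNReal.ofReal (Real.exp (-t)) := by
    rw [show ⨅ k, ENNReal.ofReal (Real.exp (-jumpTime i ω (k + 1))) = 0 from hω]
    exact ENNReal.ofReal_pos.2 (Real.exp_pos _)
  obtain ⟨k, hk⟩ := iInf_lt_iff.1 this
  rw [ENNReal.ofReal_lt_ofReal_iff (Real.exp_pos _), Real.exp_lt_exp, neg_lt_neg_iff] at hk
  exact ⟨k, by exact_mod_cast hk⟩

/-- The paths without explosion, without instantaneous phases and without fictitious jumps. -/
structure IsRegular (ω : PathSpace n) : Prop where
  nonexplosive : IsNonexplosive ω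
  hold_pos : ∀ k i, 0 < ((ω k).1 i).1
  mark_ne : ∀ k i, ((ω k).1 i).2 ≠ i.castSucc

theorem ae_isRegular : ∀ᵐ ω ∂p.P, IsRegular ω := by
  filter_upwards [p.ae_isNonexplosive,
    ae_all_iff.2 fun k => ae_all_iff.2 fun i => p.ae_step (p.hold_pos_ae i) k,
    ae_all_iff.2 fun k => ae_all_iff.2 fun i => p.ae_step (p.mark_ne_ae i) k] with ω h1 h2 h3
  exact ⟨h1, h2, h3⟩

theorem IsRegular.observed_zero {ω : PathSpace n} (h : IsRegular ω) (i : Fin n) :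
    observed i 0 ω = (i, 0, 0) := observed_of_lt (h.hold_pos 0 i)

theorem hold_le_of_isClaimTime {ω : PathSpace n} {i : Fin n} {s : ℝ≥0}
    (hs : IsClaimTime i s ω) : hold i ω 0 ≤ s := by
  obtain ⟨k, rfl, -⟩ := hs
  exact hold_zero_le_jumpTime i ω k

theorem isClaimTime_consPath_add {i : Fin n} {a : StepNoise n} {ω : PathSpace n} {s : ℝ≥0}
    (hs : IsClaimTime (nextPhase i a) s ω) :
    IsClaimTime i ((a.1 i).1 + s) (consPath a ω) := by
  obtain ⟨k, rfl, hk⟩ := hs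
  exact ⟨k + 1, jumpTime_consPath_succ i a ω (k + 1), by rwa [entered_consPath_succ]⟩

theorem IsClaimTime.of_consPath {i : Fin n} {a : StepNoise n} {ω : PathSpace n} {s : ℝ≥0}
    (hs : IsClaimTime i s (consPath a ω)) :
    s = (a.1 i).1 ∨ ∃ u, s = (a.1 i).1 + u ∧ IsClaimTime (nextPhase i a) u ω := by
  obtain ⟨k, rfl, hk⟩ := hs
  cases k with
  | zero => exact Or.inl (jumpTime_one i _)
  | succ k =>
    refine Or.inr ⟨_, jumpTime_consPath_succ i a ω (k + 1), k, rfl, ?_⟩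
    rwa [entered_consPath_succ] at hk

end RiskParams

/-! ### Left-continuous adapted processes are predictable -/

/-- For `t > 0` this is the last point of the grid of mesh `1 / (m + 1)` strictly before `t`; for `t
= 0` truncated subtraction makes it `0`. Left-continuous processes are reduced to countably many
times through these points. -/
theorem tendsto_ceil_pred_div (t : ℝ≥0) :
    Tendsto (fun m : ℕ => ((⌈t * (m + 1)⌉₊ - 1 : ℕ) : ℝ≥0) / (m + 1)) atTop (𝓝[≤] t) := by
  have hle : ∀ m : ℕ, ((⌈t * (m + 1)⌉₊ - 1 : ℕ) : ℝ≥0) / (m + 1) ≤ t := by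
    intro m
    rw [div_le_iff₀ (by positivity)]
    rcases Nat.eq_zero_or_pos ⌈t * (m + 1)⌉₊ with h | h
    · simp [h]
    · exact (Nat.lt_ceil.1 (Nat.sub_lt h one_pos)).le
  refine tendsto_nhdsWithin_iff.2 ⟨?_, Eventually.of_forall hle⟩
  have hge : ∀ m : ℕ, t - 1 / ((m : ℝ≥0) + 1) ≤ ((⌈t * (m + 1)⌉₊ - 1 : ℕ) : ℝ≥0) / (m + 1) := by
    intro m
    rw [le_div_iff₀ (by positivity), tsub_mul, one_div, inv_mul_cancel₀ (by positivity),
      tsub_le_iff_right]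
    refine (Nat.le_ceil _).trans ?_
    have : ⌈t * (m + 1)⌉₊ ≤ ⌈t * (m + 1)⌉₊ - 1 + 1 := by omega
    exact_mod_cast this
  refine tendsto_of_tendsto_of_tendsto_of_le_of_le ?_ tendsto_const_nhds hge hle
  have h0 : Tendsto (fun m : ℕ => 1 / ((m : ℝ≥0) + 1)) atTop (𝓝 0) :=
    tendsto_one_div_add_atTop_nhds_zero_nat
  simpa using (tendsto_const_nhds (x := t)).sub h0

/-- The process is the limit of its values at the last grid point. Each approximation is constant in
time on every grid interval `Ioc` and known at its left end, hence built from predictable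
rectangles. -/
theorem isStronglyPredictable_of_leftContinuous {Ω : Type*} {m : MeasurableSpace Ω}
    {𝓕 : Filtration ℝ≥0 m} {D : ℝ≥0 → Ω → ℝ} (had : ∀ t, Measurable[𝓕 t] (D t))
    (hlc : ∀ ω t, ContinuousWithinAt (fun t => D t ω) (Iic t) t) :
    IsStronglyPredictable 𝓕 D := by
  let : MeasurableSpace (ℝ≥0 × Ω) := 𝓕.predictable
  refine Measurable.stronglyMeasurable ?_
  refine measurable_of_tendsto_metrizable (f := fun (m : ℕ) (q : ℝ≥0 × Ω) =>
    D (((⌈q.1 * (m + 1)⌉₊ - 1 : ℕ) : ℝ≥0) / (m + 1)) q.2) ?_ ?_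
  · intro m B hB
    have : (fun q : ℝ≥0 × Ω => D (((⌈q.1 * (m + 1)⌉₊ - 1 : ℕ) : ℝ≥0) / (m + 1)) q.2) ⁻¹' B =
        ({⊥} ×ˢ (D 0 ⁻¹' B)) ∪ ⋃ k : ℕ, Ioc ((k : ℝ≥0) / (m + 1)) ((k + 1) / (m + 1)) ×ˢ
          (D ((k : ℝ≥0) / (m + 1)) ⁻¹' B) := by
      ext ⟨t, ω⟩
      simp only [mem_preimage, mem_union, mem_prod, mem_singleton_iff, mem_iUnion]
      have hm : (0 : ℝ≥0) < m + 1 := by positivity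
      have hk : ∀ k : ℕ, t ∈ Ioc ((k : ℝ≥0) / (m + 1)) ((k + 1) / (m + 1)) ↔
          ⌈t * (m + 1)⌉₊ = k + 1 := fun k => by
        rw [Nat.ceil_eq_iff (Nat.succ_ne_zero k), mem_Ioc, div_lt_iff₀ hm, le_div_iff₀ hm]
        simp
      simp only [hk]
      constructor
      · intro h
        rcases Nat.eq_zero_or_pos ⌈t * (m + 1)⌉₊ with h0 | h0
        · left
          rw [h0] at h
          have ht : t = 0 := by simpa using h0
          exact ⟨ht, by simpa using h⟩
        · exact Or.inr ⟨⌈t * (m + 1)⌉₊ - 1, by omega, h⟩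
      · rintro (⟨rfl, h⟩ | ⟨k, h1, h2⟩)
        · simpa using h
        · rw [h1]
          simpa using h2
    rw [this]
    refine MeasurableSet.union ?_ (MeasurableSet.iUnion fun k => ?_)
    · exact measurableSet_predictable_singleton_bot_prod (had _ hB)
    · exact measurableSet_predictable_Ioc_prod _ _ (had _ hB)
  · refine tendsto_pi_nhds.2 fun q => ?_
    exact (hlc q.2 q.1).tendsto.comp (tendsto_ceil_pred_div q.1)

namespace RiskParams

variable {n : ℕ} (p : RiskParams n)

/-- The completed σ-algebra of the events observed up to time `t`. -/
abbrev completed (i : Fin n) (t : ℝ≥0) : MeasurableSpace (PathSpace n) :=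
  eventuallyMeasurableSpace (naturalFiltration i t) (ae p.P)

theorem completed_mono (i : Fin n) {s t : ℝ≥0} (h : s ≤ t) : p.completed i s ≤ p.completed i t :=
  eventuallyMeasurableSpace_mono ((naturalFiltration i).mono h)

theorem measurableSet_completed_congr {i : Fin n} {t : ℝ≥0} {A B : Set (PathSpace n)}
    (hB : MeasurableSet[p.completed i t] B) (h : ∀ᵐ ω ∂p.P, ω ∈ A ↔ ω ∈ B) :
    MeasurableSet[p.completed i t] A :=
  EventuallyMeasurableSet.congr hB (eventuallyEq_set.2 h)

theorem measurable_completed_congr {β : Type*} [MeasurableSpace β] {i : Fin n} {t : ℝ≥0}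
    {f g : PathSpace n → β} (hg : Measurable[p.completed i t] g) (h : ∀ᵐ ω ∂p.P, f ω = g ω) :
    Measurable[p.completed i t] f :=
  EventuallyMeasurable.congr hg h

theorem measurable_observed_natural (i : Fin n) {s t : ℝ≥0} (h : s ≤ t) :
    Measurable[naturalFiltration i t] (observed i s) :=
  measurable_iff_comap_le.2 (le_iSup₂_of_le (f := fun s (_ : s ≤ t) => MeasurableSpace.comap
    (fun ω => (phase i s ω, claimCount i s ω, aggregateClaims i s ω)) inferInstance) s h le_rfl)

theorem measurable_observed_completed (i : Fin n) {s t : ℝ≥0} (h : s ≤ t) :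
    Measurable[p.completed i t] (observed i s) :=
  (measurable_observed_natural i h).mono le_eventuallyMeasurableSpace le_rfl

/-! ### Sections of events -/

/-- How the observed processes after the first jump arise from those of the shifted path. -/
def reobserve (i : Fin n) (a : StepNoise n) (z : Fin n × ℕ × ℝ) : Fin n × ℕ × ℝ :=
  (z.1, (if (a.1 i).2 = Fin.last n then 1 else 0) + z.2.1, firstClaim i a + z.2.2)

theorem measurable_reobserve (i : Fin n) (a : StepNoise n) : Measurable (reobserve i a) := by
  unfold reobserve
  fun_prop

theorem observed_consPath_add {ω : PathSpace n} (hω : IsNonexplosive ω) (i : Fin n)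
    (a : StepNoise n) (t : ℝ≥0) : observed i ((a.1 i).1 + t) (consPath a ω) =
      reobserve i a (observed (nextPhase i a) t ω) := by
  simp only [observed, reobserve, phase_consPath_add hω, claimCount_consPath_add hω,
    aggregateClaims_consPath_add hω]

/-- With the first step noise frozen, the observation is constant during the first sojourn and
afterwards a function of what the shifted path shows. Truncated subtraction covers a sojourn that is
still running at time `q`. -/
theorem naturalFiltration_le_map_consPath (i : Fin n) (a : StepNoise n) (q : ℝ≥0) :
    naturalFiltration i q ≤
      (p.completed (nextPhase i a) (q - (a.1 i).1)).map (consPath a) := by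
  refine iSup₂_le fun s hs => MeasurableSpace.comap_le_iff_le_map.2 ?_
  change MeasurableSpace.map _ _ ≥ _
  rw [MeasurableSpace.map_comp]
  change Measurable[p.completed (nextPhase i a) (q - (a.1 i).1)]
    fun ω => observed i s (consPath a ω)
  rcases lt_or_ge s (a.1 i).1 with h | h
  · have : (fun ω => observed i s (consPath a ω)) = fun _ => (i, 0, 0) :=
      funext fun ω => observed_of_lt h
    rw [this]
    exact measurable_const
  · obtain ⟨u, rfl⟩ := exists_add_of_le h
    refine p.measurable_completed_congr (g := fun ω => reobserve i a (observed (nextPhase i a) u ω))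
      ?_ ?_
    · exact (measurable_reobserve i a).comp
        (p.measurable_observed_completed _ (le_tsub_of_add_le_left hs))
    · filter_upwards [p.ae_isNonexplosive] with ω hω using observed_consPath_add hω i a u

/-- Only almost every `a` is possible: the sections of a null set are null for almost every first
step noise. -/
theorem ae_measurableSet_consPath {i : Fin n} {q : ℝ≥0} {A : Set (PathSpace n)}
    (hA : MeasurableSet[p.completed i q] A) : ∀ᵐ a ∂p.stepLaw,
      MeasurableSet[p.completed (nextPhase i a) (q - (a.1 i).1)] (consPath a ⁻¹' A) := by
  obtain ⟨B, hB, hAB⟩ := hA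
  filter_upwards [p.ae_ae_consPath (eventuallyEq_set.1 hAB)] with a ha
  exact p.measurableSet_completed_congr (p.naturalFiltration_le_map_consPath i a q B hB) ha

theorem ae_measurable_consPath {i : Fin n} {q : ℝ≥0} {f : PathSpace n → ℝ}
    (hf : Measurable[p.completed i q] f) : ∀ᵐ a ∂p.stepLaw,
      Measurable[p.completed (nextPhase i a) (q - (a.1 i).1)] fun ω => f (consPath a ω) := by
  -- Countably many generators allow one exceptional null set of `a` for all Borel sets.
  have hc := MeasurableSpace.countable_countableGeneratingSet (α := ℝ)
  have h : ∀ᵐ a ∂p.stepLaw, ∀ s ∈ MeasurableSpace.countableGeneratingSet ℝ,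
      MeasurableSet[p.completed (nextPhase i a) (q - (a.1 i).1)] (consPath a ⁻¹' (f ⁻¹' s)) :=
    (ae_ball_iff hc).2 fun s hs => p.ae_measurableSet_consPath
      (hf (MeasurableSpace.measurableSet_countableGeneratingSet hs))
  filter_upwards [h] with a ha
  have := @measurable_generateFrom _ _ (p.completed (nextPhase i a) (q - (a.1 i).1))
    (MeasurableSpace.countableGeneratingSet ℝ) (fun ω => f (consPath a ω)) ha
  rwa [MeasurableSpace.generateFrom_countableGeneratingSet] at this

/-! ### The first jump time is a stopping time -/

theorem ae_isRegular_shiftPath : ∀ᵐ ω ∂p.P, IsRegular (shiftPath ω) :=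
  p.ae_shiftPath p.ae_isRegular

theorem observed_hold_add {ω : PathSpace n} (hω : IsNonexplosive (shiftPath ω)) (i : Fin n)
    (t : ℝ≥0) : observed i (hold i ω 0 + t) ω =
      reobserve i (ω 0) (observed (nextPhase i (ω 0)) t (shiftPath ω)) := by
  have h := observed_consPath_add hω i (ω 0) t
  rwa [consPath_shiftPath] at h

/-- After a first jump the observation differs from its initial value throughout the second sojourn,
which has positive length. So the jump is detected at a time of a countable dense set, or at `t`
itself. -/
theorem measurableSet_hold_le (i : Fin n) (t : ℝ≥0) :
    MeasurableSet[p.completed i t] {ω | hold i ω 0 ≤ t} := by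
  obtain ⟨S, hSc, hSd⟩ := TopologicalSpace.exists_countable_dense ℝ≥0
  have hm : ∀ q ∈ insert t S ∩ Iic t, MeasurableSet[p.completed i t]
      {ω | (observed i q ω).1 ≠ i ∨ (observed i q ω).2.1 ≠ 0} := fun q hq => by
    have h := p.measurable_observed_completed i (mem_Iic.1 hq.2)
    exact h (t := {z | z.1 ≠ i ∨ z.2.1 ≠ 0})
      ((measurable_fst (measurableSet_singleton i).compl).union
        (measurable_snd.fst (measurableSet_singleton 0).compl))
  refine p.measurableSet_completed_congr (MeasurableSet.biUnion
    ((hSc.insert t).mono inter_subset_left) hm) ?_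
  filter_upwards [p.ae_isRegular, p.ae_isRegular_shiftPath] with ω hω hω'
  simp only [mem_ofPred_eq, mem_iUnion, exists_prop]
  constructor
  · intro h
    -- A jump exactly at `t` is seen by time `t` only at `t`; hence `t` is added to `S`.
    obtain ⟨u, hu, hmem⟩ : ∃ u < hold (nextPhase i (ω 0)) (shiftPath ω) 0,
        hold i ω 0 + u ∈ insert t S ∩ Iic t := by
      have hpos : 0 < hold (nextPhase i (ω 0)) (shiftPath ω) 0 := hω'.hold_pos 0 _
      rcases eq_or_lt_of_le h with h | h
      · exact ⟨0, hpos, by simp [h]⟩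
      · obtain ⟨q, hq, hq1, hq2⟩ := hSd.exists_between
          (lt_min h (lt_add_of_pos_right (hold i ω 0) hpos))
        obtain ⟨u, rfl⟩ := exists_add_of_le hq1.le
        exact ⟨u, lt_of_add_lt_add_left (hq2.trans_le (min_le_right _ _)),
          Or.inr hq, (hq2.trans_le (min_le_left _ _)).le⟩
    refine ⟨_, hmem, ?_⟩
    rw [observed_hold_add hω'.nonexplosive, observed_of_lt hu]
    by_cases hl : ((ω 0).1 i).2 = Fin.last n
    · right
      simp [reobserve, hl]
    · left
      obtain ⟨j, hj⟩ := Fin.exists_castSucc_eq.2 hl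
      have hne := hω.mark_ne 0 i
      simp only [reobserve, nextPhase, ← hj, Fin.lastCases_castSucc]
      rintro rfl
      exact hne hj.symm
  · rintro ⟨q, hq, h⟩
    by_contra hlt
    rw [observed_of_lt ((mem_Iic.1 hq.2).trans_lt (not_le.1 hlt))] at h
    simp at h

theorem measurable_min_hold (i : Fin n) (t : ℝ≥0) :
    Measurable[p.completed i t] fun ω => min (hold i ω 0) t := by
  let := p.completed i t
  refine measurable_of_Iic fun u => ?_
  rcases le_or_gt t u with h | h
  · convert MeasurableSet.univ
    ext ω
    simp [h]
  · have : (fun ω : PathSpace n => min (hold i ω 0) t) ⁻¹' Iic u = {ω | hold i ω 0 ≤ u} := by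
      ext ω
      simp [h.not_ge]
    rw [this]
    exact p.completed_mono i h.le _ (p.measurableSet_hold_le i u)

theorem measurableSet_hold_add_le (i : Fin n) (q t : ℝ≥0) :
    MeasurableSet[p.completed i t] {ω | hold i ω 0 + q ≤ t} := by
  rcases le_or_gt q t with h | h
  · have : {ω : PathSpace n | hold i ω 0 + q ≤ t} = {ω | hold i ω 0 ≤ t - q} := by
      ext ω
      exact (le_tsub_iff_right h).symm
    rw [this]
    exact p.completed_mono i tsub_le_self _ (p.measurableSet_hold_le i _)
  · convert @MeasurableSet.empty _ (p.completed i t)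
    ext ω
    simpa using h.trans_le le_add_self

/-- Right-continuity makes the observed process measurable at random times. -/
theorem measurable_observed_random {i : Fin n} {t : ℝ≥0} {σ : PathSpace n → ℝ≥0}
    (hσ : Measurable[p.completed i t] σ) (hle : ∀ ω, σ ω ≤ t) :
    Measurable[p.completed i t] fun ω => observed i (σ ω) ω := by
  intro B hB
  -- Discretize `σ` from the right, capped at `t`: these times take countably many values and
  -- converge to `σ` from above, so the observation there eventually equals the one at `σ`.
  have hg : ∀ m : ℕ, Measurable[p.completed i t] fun ω =>
      observed i (min t ((⌊σ ω * (m + 1)⌋₊ + 1) / (m + 1))) ω := by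
    intro m
    let := p.completed i t
    refine measurable_discrete_app (f := fun ω => ⌊σ ω * (m + 1)⌋₊)
      (g := fun ω k => observed i (min t ((k + 1) / (m + 1))) ω) ?_ fun k => ?_
    · exact Nat.measurable_floor.comp (hσ.mul_const _)
    · exact p.measurable_observed_completed i (min_le_left _ _)
  refine p.measurableSet_completed_congr (B := {ω | ∀ᶠ m : ℕ in atTop,
    observed i (min t ((⌊σ ω * (m + 1)⌋₊ + 1) / (m + 1))) ω ∈ B}) ?_ ?_
  · let := p.completed i t
    simp only [eventually_atTop, ofPred_exists, ofPred_forall]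
    exact MeasurableSet.iUnion fun N => MeasurableSet.iInter fun m =>
      MeasurableSet.iInter fun _ => hg m hB
  · filter_upwards [p.ae_isNonexplosive] with ω hω
    have ht : Tendsto (fun m : ℕ => min t ((⌊σ ω * (m + 1)⌋₊ + 1) / (m + 1))) atTop
        (𝓝[≥] (σ ω)) := by
      have hge : ∀ m : ℕ, σ ω ≤ min t ((⌊σ ω * (m + 1)⌋₊ + 1) / (m + 1)) := fun m =>
        le_min (hle ω) ((le_div_iff₀ (by positivity)).2 (Nat.lt_floor_add_one _).le)
      refine tendsto_nhdsWithin_iff.2 ⟨?_, Eventually.of_forall hge⟩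
      have hub : ∀ m : ℕ, min t ((⌊σ ω * (m + 1)⌋₊ + 1) / (m + 1)) ≤
          σ ω + 1 / ((m : ℝ≥0) + 1) := fun m => by
        refine (min_le_right _ _).trans ?_
        rw [add_div]
        gcongr
        exact (div_le_iff₀ (by positivity)).2 (Nat.floor_le (zero_le (a := σ ω * (m + 1))))
      refine tendsto_of_tendsto_of_tendsto_of_le_of_le tendsto_const_nhds ?_ hge hub
      have h0 : Tendsto (fun m : ℕ => 1 / ((m : ℝ≥0) + 1)) atTop (𝓝 0) :=
        tendsto_one_div_add_atTop_nhds_zero_nat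
      simpa using (tendsto_const_nhds (x := σ ω)).add h0
    have he := ht.eventually (observed_eventuallyEq hω i (σ ω))
    constructor
    · intro h
      filter_upwards [he] with m hm
      rwa [hm]
    · intro h
      obtain ⟨m, h1, h2⟩ := (h.and he).exists
      rwa [h2] at h1

/-- What is observed at the first jump time, if this time is at most `t`. -/
theorem measurable_observed_min_hold (i : Fin n) (s t : ℝ≥0) :
    Measurable[p.completed i t] fun ω => observed i (min (min (hold i ω 0) t + s) t) ω := by
  refine p.measurable_observed_random ?_ fun ω => min_le_right _ _
  let := p.completed i t
  exact ((p.measurable_min_hold i t).add_const s).min measurable_const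

theorem observed_min_hold_eq {ω : PathSpace n} (hω' : IsNonexplosive (shiftPath ω)) {i : Fin n}
    {s t : ℝ≥0} (h : hold i ω 0 + s ≤ t) :
    observed i (min (min (hold i ω 0) t + s) t) ω =
      reobserve i (ω 0) (observed (nextPhase i (ω 0)) s (shiftPath ω)) := by
  rw [min_eq_left (le_self_add.trans h), min_eq_left h, observed_hold_add hω']

/-- The data of the first jump are known once it has occurred. -/
theorem exists_measurable_firstJump (i : Fin n) (t : ℝ≥0) : ∃ Z : PathSpace n → Fin n × ℕ × ℝ,
    Measurable[p.completed i t] Z ∧ ∀ᵐ ω ∂p.P, hold i ω 0 ≤ t → Z ω =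
      (nextPhase i (ω 0), if ((ω 0).1 i).2 = Fin.last n then 1 else 0, firstClaim i (ω 0)) := by
  refine ⟨_, p.measurable_observed_min_hold i 0 t, ?_⟩
  filter_upwards [p.ae_isRegular_shiftPath] with ω hω' h
  rw [observed_min_hold_eq hω'.nonexplosive (by simpa using h), hω'.observed_zero]
  simp [reobserve]

/-- If the first jump leaves at least `q` units of time before `t`, whatever the shifted path
reveals by `q` is known at `t`. The sets for which this holds form a σ-algebra containing the
generators. -/
theorem measurableSet_inter_shiftPath {i j : Fin n} {q t : ℝ≥0} {B : Set (PathSpace n)}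
    (hB : MeasurableSet[p.completed j q] B) : MeasurableSet[p.completed i t]
      ({ω | hold i ω 0 + q ≤ t ∧ nextPhase i (ω 0) = j} ∩ shiftPath ⁻¹' B) := by
  set H : Set (PathSpace n) := {ω | hold i ω 0 + q ≤ t ∧ nextPhase i (ω 0) = j} with hHdef
  obtain ⟨Z, hZm, hZ⟩ := p.exists_measurable_firstJump i t
  have hH : MeasurableSet[p.completed i t] H := by
    refine p.measurableSet_completed_congr (B := {ω | hold i ω 0 + q ≤ t} ∩ {ω | (Z ω).1 = j}) ?_ ?_
    · let := p.completed i t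
      exact (p.measurableSet_hold_add_le i q t).inter (hZm.fst (measurableSet_singleton j))
    · filter_upwards [hZ] with ω hω
      simp only [hHdef, mem_ofPred_eq, mem_inter_iff]
      refine and_congr_right fun h => ?_
      rw [hω (le_self_add.trans h)]
  let M : MeasurableSpace (PathSpace n) :=
    { MeasurableSet' := fun B => MeasurableSet[p.completed i t] (H ∩ shiftPath ⁻¹' B)
      measurableSet_empty := by simp
      measurableSet_compl := fun B hB => by
        have : H ∩ shiftPath ⁻¹' Bᶜ = H \ (H ∩ shiftPath ⁻¹' B) := by
          ext ω
          simp
        rw [this]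
        exact @MeasurableSet.diff _ (p.completed i t) _ _ hH hB
      measurableSet_iUnion := fun f hf => by
        rw [preimage_iUnion, inter_iUnion]
        exact @MeasurableSet.iUnion _ _ (p.completed i t) _ _ hf }
  have hle : naturalFiltration j q ≤ M := by
    refine iSup₂_le fun s hs => ?_
    rintro _ ⟨E, hE, rfl⟩
    change MeasurableSet[p.completed i t] (H ∩ shiftPath ⁻¹' (observed j s ⁻¹' E))
    -- Subtracting the data of the first jump undoes `reobserve`; the subtraction of claim counts is
    -- exact on `H`, almost surely.
    have hm : Measurable[p.completed i t] fun ω : PathSpace n =>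
        ((observed i (min (min (hold i ω 0) t + s) t) ω).1,
          (observed i (min (min (hold i ω 0) t + s) t) ω).2.1 - (Z ω).2.1,
          (observed i (min (min (hold i ω 0) t + s) t) ω).2.2 - (Z ω).2.2) := by
      let := p.completed i t
      have h1 := p.measurable_observed_min_hold i s t
      exact h1.fst.prodMk ((h1.snd.fst.sub hZm.snd.fst).prodMk (h1.snd.snd.sub hZm.snd.snd))
    refine p.measurableSet_completed_congr (@MeasurableSet.inter _ (p.completed i t) _ _ hH
      (hm hE)) ?_
    filter_upwards [hZ, p.ae_isRegular_shiftPath] with ω hω hω'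
    simp only [mem_inter_iff, mem_preimage]
    refine and_congr_right fun h => ?_
    have hst : hold i ω 0 + s ≤ t := (add_le_add_right hs _).trans h.1
    rw [hω (le_self_add.trans h.1), observed_min_hold_eq hω'.nonexplosive hst, h.2]
    simp [reobserve, firstClaim]
  obtain ⟨B', hB', hBB'⟩ := hB
  refine p.measurableSet_completed_congr (hle B' hB') ?_
  filter_upwards [p.ae_shiftPath (eventuallyEq_set.1 hBB')] with ω hω
  simp only [mem_inter_iff, mem_preimage, hω]


/-! ### Regularity of admissible strategies -/

section admissible

variable {p} {i : Fin n} {x : ℝ≥0} {D : DividendProcess n}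

theorem IsAdmissible.path (hD : p.IsAdmissible i x D) (ω : PathSpace n) :
    IsDividendPath fun t => D t ω where
  mono := hD.monotone ω
  leftCont := hD.leftContinuous ω
  zero := hD.zero ω

theorem IsAdmissible.measurable_completed (hD : p.IsAdmissible i x D) (t : ℝ≥0) :
    Measurable[p.completed i t] (D t) := by
  let := p.completed i t
  exact StronglyMeasurable.measurable (hD.predictable.stronglyAdapted t)

theorem aemeasurable_of_completed {f : PathSpace n → ℝ} {t : ℝ≥0}
    (hf : Measurable[p.completed i t] f) : AEMeasurable f p.P :=
  NullMeasurable.aemeasurable fun s hs => by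
    obtain ⟨B, hB, h⟩ := hf hs
    exact NullMeasurableSet.congr (((naturalFiltration i).le t B hB).nullMeasurableSet) h.symm

theorem IsAdmissible.of_adapted (hm : ∀ t, Measurable[p.completed i t] (D t))
    (hpath : ∀ ω, IsDividendPath fun t => D t ω)
    (hs : ∀ᵐ ω ∂p.P, ∀ t, p.surplus i x D t ω < 0 →
      ∃ s ≤ t, IsClaimTime i s ω ∧ p.surplus i x D s ω < 0) : p.IsAdmissible i x D where
  predictable := isStronglyPredictable_of_leftContinuous hm fun ω => (hpath ω).leftCont
  monotone ω := (hpath ω).mono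
  leftContinuous ω := (hpath ω).leftCont
  zero ω := (hpath ω).zero
  solvent := hs

end admissible

/-! ### Absence of information before the first jump -/

theorem measurable_hold_zero (i : Fin n) : Measurable fun ω : PathSpace n => hold i ω 0 :=
  measurable_hold i 0

theorem measure_lt_hold_pos (i : Fin n) (t : ℝ≥0) : p.P {ω | t < hold i ω 0} ≠ 0 := by
  have h := (p.measurePreserving_hold i).comp
    (measurePreserving_eval_infinitePi (fun _ : ℕ => p.stepLaw) 0)
  have h1 := h.measure_preimage (s := Ioi t) measurableSet_Ioi.nullMeasurableSet
  rw [expLaw_Ioi (p.rate_pos i)] at h1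
  have h2 : p.P {ω | t < hold i ω 0} = ENNReal.ofReal (Real.exp (-p.rate i * t)) := h1
  rw [h2]
  exact (ENNReal.ofReal_pos.2 (Real.exp_pos _)).ne'

/-- Two paths still in their first sojourn have shown the same constant observation, so no event of
the natural filtration separates them. -/
theorem mem_iff_of_lt_hold {i : Fin n} {q : ℝ≥0} {B : Set (PathSpace n)}
    (hB : MeasurableSet[naturalFiltration i q] B) {ω₁ ω₂ : PathSpace n}
    (h₁ : q < hold i ω₁ 0) (h₂ : q < hold i ω₂ 0) : ω₁ ∈ B ↔ ω₂ ∈ B := by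
  let M : MeasurableSpace (PathSpace n) :=
    { MeasurableSet' := fun B => ω₁ ∈ B ↔ ω₂ ∈ B
      measurableSet_empty := by simp
      measurableSet_compl := fun B hB => by simp only [mem_compl_iff, hB]
      measurableSet_iUnion := fun f hf => by simp only [mem_iUnion, hf] }
  have hle : naturalFiltration i q ≤ M := by
    refine iSup₂_le fun s hs => ?_
    rintro _ ⟨E, hE, rfl⟩
    change observed i s ω₁ ∈ E ↔ observed i s ω₂ ∈ E
    rw [observed_of_lt (hs.trans_lt h₁), observed_of_lt (hs.trans_lt h₂)]
  exact hle B hB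

section admissible

variable {p} {i : Fin n} {x : ℝ≥0} {D : DividendProcess n}

/-- On `{q < hold i ω 0}` every event known at `q` is null or conull, and a real function whose
Borel preimages all have this property is almost surely constant. -/
theorem exists_const_of_lt_hold {f : PathSpace n → ℝ} {q : ℝ≥0}
    (hf : Measurable[p.completed i q] f) :
    ∃ c, ∀ᵐ ω ∂p.P, q < hold i ω 0 → f ω = c := by
  have hm : MeasurableSet {ω : PathSpace n | q < hold i ω 0} :=
    measurableSet_lt measurable_const (measurable_hold_zero i)
  have key : ∀ U, MeasurableSet U → (∀ᵐ ω ∂p.P.restrict {ω | q < hold i ω 0}, f ω ∈ U) ∨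
      ∀ᵐ ω ∂p.P.restrict {ω | q < hold i ω 0}, f ω ∉ U := by
    intro U hU
    obtain ⟨B, hB, h⟩ := hf hU
    rw [ae_restrict_iff' hm, ae_restrict_iff' hm]
    by_cases hne : ∃ ω₁ ∈ B, q < hold i ω₁ 0
    · obtain ⟨ω₁, h1, h2⟩ := hne
      left
      filter_upwards [eventuallyEq_set.1 h] with ω hω hlt
      exact hω.2 ((mem_iff_of_lt_hold hB h2 hlt).1 h1)
    · right
      filter_upwards [eventuallyEq_set.1 h] with ω hω hlt hmem
      exact hne ⟨ω, hω.1 hmem, hlt⟩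
  obtain ⟨c, hc⟩ := exists_eventuallyEq_const_of_forall_separating MeasurableSet key
  exact ⟨c, (ae_restrict_iff' hm).1 hc⟩

theorem IsAdmissible.ae_le_of_lt_hold (hD : p.IsAdmissible i x D) :
    ∀ᵐ ω ∂p.P, ∀ t < hold i ω 0, D t ω ≤ x + p.c * t := by
  filter_upwards [hD.solvent] with ω hω t ht
  by_contra hlt
  obtain ⟨s, hs, hcl, -⟩ := hω t (by
    rw [surplus, reserve, aggregateClaims_of_lt ht]
    linarith [not_le.1 hlt])
  exact absurd (hold_le_of_isClaimTime hcl) (not_le.2 (hs.trans_lt ht))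

/-- Before the first jump an admissible strategy is deterministic. -/
theorem IsAdmissible.exists_path (hD : p.IsAdmissible i x D) :
    ∃ d, IsDividendPath d ∧ (∀ t : ℝ≥0, d t ≤ x + p.c * t) ∧
      ∀ᵐ ω ∂p.P, ∀ t ≤ hold i ω 0, D t ω = d t := by
  obtain ⟨S, hSc, hSd⟩ := TopologicalSpace.exists_countable_dense ℝ≥0
  choose c hc using fun q => exists_const_of_lt_hold (hD.measurable_completed q)
  let G : PathSpace n → Prop := fun ω =>
    (∀ q ∈ S, q < hold i ω 0 → D q ω = c q) ∧ ∀ t < hold i ω 0, D t ω ≤ x + p.c * t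
  have hG : ∀ᵐ ω ∂p.P, G ω := by
    filter_upwards [(ae_ball_iff hSc).2 fun q _ => hc q, hD.ae_le_of_lt_hold] with ω h1 h2
      using ⟨h1, h2⟩
  -- Arbitrarily long first sojourns have positive probability, so the full-measure set `G` contains
  -- some.
  have hex : ∀ N : ℕ, ∃ ω, G ω ∧ (N : ℝ≥0) < hold i ω 0 := by
    intro N
    by_contra hcon
    push Not at hcon
    refine p.measure_lt_hold_pos i N (measure_mono_null (t := {ω | ¬ G ω}) ?_ hG)
    exact fun ω hω hg => absurd (hcon ω hg) (not_le.2 hω)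
  choose w hwG hw using hex
  -- Agreement at the countable dense times extends by monotonicity and left-continuity to all
  -- times, including the jump time itself.
  have hle : ∀ ω ω', G ω → G ω' → ∀ t, t ≤ hold i ω 0 → t ≤ hold i ω' 0 → D t ω ≤ D t ω' := by
    intro ω ω' hg hg' t ht ht'
    rcases eq_or_lt_of_le (zero_le (a := t)) with h0 | h0
    · rw [← h0, hD.zero, hD.zero]
    · have : (𝓝[<] t).NeBot := nhdsLT_neBot_of_exists_lt ⟨0, h0⟩
      refine le_of_tendsto ((hD.leftContinuous ω t).mono Iio_subset_Iic_self) ?_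
      refine eventually_nhdsWithin_of_forall fun s hs => ?_
      obtain ⟨q, hq, h1, h2⟩ := hSd.exists_between (mem_Iio.1 hs)
      calc D s ω ≤ D q ω := hD.monotone ω h1.le
        _ = D q ω' := by rw [hg.1 q hq (h2.trans_le ht), hg'.1 q hq (h2.trans_le ht')]
        _ ≤ D t ω' := hD.monotone ω' h2.le
  have heq : ∀ ω ω', G ω → G ω' → ∀ t, t ≤ hold i ω 0 → t ≤ hold i ω' 0 → D t ω = D t ω' :=
    fun ω ω' hg hg' t ht ht' => le_antisymm (hle ω ω' hg hg' t ht ht') (hle ω' ω hg' hg t ht' ht)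
  -- The common path is read off at `t` from a good path whose first sojourn outlasts `t`.
  have hlt : ∀ t : ℝ≥0, t < hold i (w ⌈t⌉₊) 0 := fun t => (Nat.le_ceil t).trans_lt (hw _)
  have hd : ∀ s t, s ≤ t → D s (w ⌈s⌉₊) = D s (w ⌈t⌉₊) := fun s t hst =>
    heq _ _ (hwG _) (hwG _) s (hlt s).le (hst.trans (hlt t).le)
  refine ⟨fun t => D t (w ⌈t⌉₊), ⟨fun s t hst => ?_, fun t => ?_, hD.zero _⟩,
    fun t => (hwG _).2 t (hlt t), ?_⟩
  · exact (hd s t hst).trans_le (hD.monotone _ hst)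
  · exact (hD.leftContinuous (w ⌈t⌉₊) t).congr (fun s hs => hd s t hs) rfl
  · filter_upwards [hG] with ω hω t ht
    exact heq _ _ hω (hwG _) t ht (hlt t).le

/-! ### Measurability of the payoff -/

theorem IsDividendPath.ofReal_eq_iSup {d : ℝ≥0 → ℝ} (hd : IsDividendPath d) (t : ℝ≥0) :
    ENNReal.ofReal (d t) =
      ⨆ m : ℕ, ENNReal.ofReal (d (((⌈t * (m + 1)⌉₊ - 1 : ℕ) : ℝ≥0) / (m + 1))) := by
  have ht := tendsto_ceil_pred_div t
  refine le_antisymm ?_ (iSup_le fun m => ENNReal.ofReal_le_ofReal (hd.mono ?_))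
  · exact le_of_tendsto' ((ENNReal.continuous_ofReal.tendsto _).comp
      ((hd.leftCont t).tendsto.comp ht)) fun m => le_iSup (fun m : ℕ =>
        ENNReal.ofReal (d (((⌈t * (m + 1)⌉₊ - 1 : ℕ) : ℝ≥0) / (m + 1)))) m
  · rw [div_le_iff₀ (by positivity)]
    rcases Nat.eq_zero_or_pos ⌈t * (m + 1)⌉₊ with h | h
    · simp [h]
    · exact (Nat.lt_ceil.1 (Nat.sub_lt h one_pos)).le

/-- Each `D t` is measurable only up to a null set; a jointly measurable version is rebuilt from the
countably many grid times. -/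
theorem IsAdmissible.exists_measurable_version (hD : p.IsAdmissible i x D) :
    ∃ E : ℝ≥0 × PathSpace n → ℝ≥0∞, Measurable E ∧
      ∀ᵐ ω ∂p.P, ∀ t, ENNReal.ofReal (D t ω) = E (t, ω) := by
  have hm : ∀ m k : ℕ, AEMeasurable (fun ω => ENNReal.ofReal (D ((k : ℝ≥0) / (m + 1)) ω)) p.P :=
    fun m k => (aemeasurable_of_completed (hD.measurable_completed _)).ennreal_ofReal
  refine ⟨fun q => ⨆ m : ℕ, (hm m (⌈q.1 * (m + 1)⌉₊ - 1)).mk _ q.2, ?_, ?_⟩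
  · refine Measurable.iSup fun m => ?_
    refine measurable_discrete_app (f := fun q : ℝ≥0 × PathSpace n => ⌈q.1 * (m + 1)⌉₊ - 1)
      (g := fun q k => (hm m k).mk _ q.2) ?_ fun k => ?_
    · exact (measurable_of_countable fun k : ℕ => k - 1).comp
        (Nat.measurable_ceil.comp (measurable_fst.mul_const _))
    · exact (hm m k).measurable_mk.comp measurable_snd
  · filter_upwards [ae_all_iff.2 fun m => ae_all_iff.2 fun k => (hm m k).ae_eq_mk] with ω hω t
    rw [IsDividendPath.ofReal_eq_iSup (hD.path ω) t]
    exact iSup_congr fun m => hω m _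

/-- Claims and dividends only lower the surplus, so it rises at rate at most `c`. A negative surplus
therefore stays negative for a positive time, and a countable dense set of times determines the
infimum. -/
theorem aemeasurable_ruinTime (hm : ∀ t, AEMeasurable (D t) p.P)
    (hmono : ∀ ω, Monotone fun t => D t ω) : AEMeasurable (p.ruinTime i x D) p.P := by
  obtain ⟨S, hSc, hSd⟩ := TopologicalSpace.exists_countable_dense ℝ≥0
  have := hSc.to_subtype
  refine AEMeasurable.congr (f := fun ω => ⨅ q : S,
    if p.surplus i x D q ω < 0 then ((q : ℝ≥0) : ℝ≥0∞) else ⊤) ?_ ?_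
  · refine AEMeasurable.iInf fun q => Measurable.comp_aemeasurable (f := p.surplus i x D q)
      (g := fun z : ℝ => if z < 0 then ((q : ℝ≥0) : ℝ≥0∞) else ⊤) ?_ ?_
    · exact Measurable.ite measurableSet_Iio measurable_const measurable_const
    · exact ((measurable_const.sub (measurable_aggregateClaims i q)).aemeasurable).sub (hm q)
  · filter_upwards [p.ae_isNonexplosive] with ω hω
    refine le_antisymm (le_iInf₂ fun t ht => ?_) (le_iInf fun q => ?_)
    · refine le_of_forall_gt_imp_ge_of_dense fun b hb => ?_
      obtain ⟨u, htu, hub⟩ := ENNReal.lt_iff_exists_nnreal_btwn.1 hb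
      have hη : 0 < -p.surplus i x D t ω / p.c := div_pos (neg_pos.2 ht) p.c_pos
      obtain ⟨q, hq, h1, h2⟩ := hSd.exists_between
        (lt_min (ENNReal.coe_lt_coe.1 htu) (lt_add_of_pos_right t (Real.toNNReal_pos.2 hη)))
      refine (iInf_le _ ⟨q, hq⟩).trans ?_
      have hneg : p.surplus i x D q ω < 0 := by
        have h3 : (q : ℝ) < t + -p.surplus i x D t ω / p.c := by
          have := h2.trans_le (min_le_right _ _)
          rw [← NNReal.coe_lt_coe] at this
          rwa [NNReal.coe_add, Real.coe_toNNReal _ hη.le] at this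
        have h4 : p.c * (q - t) < -p.surplus i x D t ω := by
          rw [mul_comm, ← lt_div_iff₀ p.c_pos]
          linarith
        have h5 := aggregateClaims_mono hω i h1.le
        have h6 := hmono ω h1.le
        simp only [surplus, reserve] at h4 ⊢
        dsimp only at h6
        linarith
      simp only [if_pos hneg]
      exact (ENNReal.coe_le_coe.2 (h2.trans_le (min_le_left _ _)).le).trans hub.le
    · split_ifs with h
      · exact iInf₂_le (q : ℝ≥0) h
      · exact le_top

variable (p) in
/-- The discounted dividends paid strictly before ruin. -/
def paidBeforeRuin (i : Fin n) (x : ℝ≥0) (D : DividendProcess n) (ω : PathSpace n) : ℝ≥0∞ :=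
  p.discounted {t | 0 ≤ t ∧ ENNReal.ofReal t < p.ruinTime i x D ω} fun t => D t ω

theorem payoff_eq_lintegral (i : Fin n) (x : ℝ≥0) (D : DividendProcess n) :
    p.payoff i x D = ∫⁻ ω, p.paidBeforeRuin i x D ω ∂p.P := rfl

theorem IsAdmissible.aemeasurable_paidBeforeRuin (hD : p.IsAdmissible i x D) :
    AEMeasurable (p.paidBeforeRuin i x D) p.P := by
  have := isProbabilityMeasure_expLaw p.δ_pos
  obtain ⟨E, hE, hDE⟩ := hD.exists_measurable_version
  have hr := aemeasurable_ruinTime (i := i) (x := x)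
    (fun t => aemeasurable_of_completed (hD.measurable_completed t)) hD.monotone
  refine ⟨fun ω => ∫⁻ s, E (stopAt (hr.mk _ ω) s, ω) ∂expLaw p.δ, ?_, ?_⟩
  · refine Measurable.lintegral_prod_right'
      (f := fun q : PathSpace n × ℝ≥0 => E (stopAt (hr.mk _ q.1) q.2, q.1)) ?_
    exact hE.comp ((measurable_stopAt.comp ((hr.measurable_mk.comp measurable_fst).prodMk
      measurable_snd)).prodMk measurable_fst)
  · filter_upwards [hDE, hr.ae_eq_mk] with ω h1 h2
    rw [paidBeforeRuin, p.discounted_eq (hD.path ω), h2]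
    simp_rw [h1]

/-! ### Splitting a strategy at the first jump -/

/-- The strategy that remains after the first sojourn, with step noise `a`. -/
def residual (D : DividendProcess n) (i : Fin n) (a : StepNoise n) : DividendProcess n :=
  fun t ω => D ((a.1 i).1 + t) (consPath a ω) - D (a.1 i).1 (consPath a ω)

variable (p) in
/-- The surplus after the first jump, for the dividends `d` in the first sojourn. -/
def nextSurplus (i : Fin n) (x : ℝ≥0) (d : ℝ≥0 → ℝ) (a : StepNoise n) : ℝ :=
  x + p.c * (a.1 i).1 - d (a.1 i).1 - firstClaim i a

variable {d : ℝ≥0 → ℝ} {a : StepNoise n} {ω : PathSpace n}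

theorem surplus_consPath_add (hω : IsNonexplosive ω)
    (hd : D (a.1 i).1 (consPath a ω) = d (a.1 i).1) (t : ℝ≥0) :
    p.surplus i x D ((a.1 i).1 + t) (consPath a ω) =
      p.nextSurplus i x d a + p.c * t - aggregateClaims (nextPhase i a) t ω -
        residual D i a t ω := by
  rw [surplus, reserve, aggregateClaims_consPath_add hω, nextSurplus, residual, hd]
  push_cast
  ring

theorem surplus_consPath_add' (hω : IsNonexplosive ω)
    (hd : D (a.1 i).1 (consPath a ω) = d (a.1 i).1) (hy : 0 ≤ p.nextSurplus i x d a) (t : ℝ≥0) :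
    p.surplus i x D ((a.1 i).1 + t) (consPath a ω) =
      p.surplus (nextPhase i a) (p.nextSurplus i x d a).toNNReal (residual D i a) t ω := by
  rw [surplus_consPath_add hω hd, surplus, reserve, Real.coe_toNNReal _ hy]

/-- Ruin happens only by claims, on the path `ω`. -/
def IsSolventOn (p : RiskParams n) (i : Fin n) (x : ℝ≥0) (D : DividendProcess n)
    (ω : PathSpace n) : Prop :=
  ∀ t, p.surplus i x D t ω < 0 → ∃ s ≤ t, IsClaimTime i s ω ∧ p.surplus i x D s ω < 0

theorem hold_le_of_surplus_neg {ω : PathSpace n} (h : p.IsSolventOn i x D ω) {t : ℝ≥0}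
    (ht : p.surplus i x D t ω < 0) : hold i ω 0 ≤ t := by
  obtain ⟨s, hs, hcl, -⟩ := h t ht
  exact (hold_le_of_isClaimTime hcl).trans hs

/-- Solvency excludes ruin before the first jump. A negative surplus after that jump means ruin
exactly then, which is the summand `0`. -/
theorem ruinTime_consPath (hω : IsRegular ω) (hs : p.IsSolventOn i x D (consPath a ω))
    (hd : D (a.1 i).1 (consPath a ω) = d (a.1 i).1) :
    p.ruinTime i x D (consPath a ω) = (a.1 i).1 + if 0 ≤ p.nextSurplus i x d a then
      p.ruinTime (nextPhase i a) (p.nextSurplus i x d a).toNNReal (residual D i a) ω else 0 := by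
  split_ifs with hy
  · refine le_antisymm ?_ (le_iInf₂ fun t ht => ?_)
    · rw [ruinTime, ruinTime, ENNReal.add_iInf]
      refine le_iInf fun t => ?_
      by_cases ht : p.surplus (nextPhase i a) (p.nextSurplus i x d a).toNNReal
          (residual D i a) t ω < 0
      · rw [iInf_pos ht, ← ENNReal.coe_add]
        refine iInf₂_le _ ?_
        rwa [surplus_consPath_add' hω.nonexplosive hd hy]
      · simp [iInf_neg ht]
    · have hle := hold_le_of_surplus_neg hs ht
      rw [hold_consPath_zero] at hle
      obtain ⟨u, rfl⟩ := exists_add_of_le hle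
      rw [ENNReal.coe_add]
      gcongr
      refine iInf₂_le u ?_
      rwa [← surplus_consPath_add' hω.nonexplosive hd hy]
  · rw [add_zero]
    refine le_antisymm (iInf₂_le (a.1 i).1 ?_) (le_iInf₂ fun t ht => ?_)
    · have h := surplus_consPath_add (p := p) (x := x) hω.nonexplosive hd 0
      rw [add_zero] at h
      rw [h, aggregateClaims_of_lt (hω.hold_pos 0 _)]
      simpa [residual] using hy
    · exact ENNReal.coe_le_coe.2 (hold_le_of_surplus_neg hs ht)

theorem discounted_congr {d d' : ℝ≥0 → ℝ} (hd : IsDividendPath d) (hd' : IsDividendPath d')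
    {τ : ℝ≥0} (h : ∀ t ≤ τ, d t = d' t) :
    p.discounted (Ico 0 (τ : ℝ)) d = p.discounted (Ico 0 (τ : ℝ)) d' := by
  rw [p.discounted_Ico hd, p.discounted_Ico hd']
  exact lintegral_congr fun s => by rw [h _ (min_le_right _ _)]

theorem paidBeforeRuin_consPath (hω : IsRegular ω) (hs : p.IsSolventOn i x D (consPath a ω))
    (hpath : IsDividendPath fun t => D t (consPath a ω)) (hd : IsDividendPath d)
    (hDd : ∀ t ≤ (a.1 i).1, D t (consPath a ω) = d t) :
    p.paidBeforeRuin i x D (consPath a ω) = p.discounted (Ico 0 ((a.1 i).1 : ℝ)) d +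
      ENNReal.ofReal (Real.exp (-p.δ * (a.1 i).1)) * if 0 ≤ p.nextSurplus i x d a then
        p.paidBeforeRuin (nextPhase i a) (p.nextSurplus i x d a).toNNReal (residual D i a) ω
        else 0 := by
  rw [paidBeforeRuin, ruinTime_consPath hω hs (hDd _ le_rfl), p.discounted_add hpath,
    discounted_congr hpath hd hDd]
  congr 2
  split_ifs with hy
  · rfl
  · rw [discounted]
    simp

theorem IsAdmissible.ae_split (hD : p.IsAdmissible i x D)
    (hDd : ∀ᵐ ω ∂p.P, ∀ t ≤ hold i ω 0, D t ω = d t) :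
    ∀ᵐ a ∂p.stepLaw, ∀ᵐ ω ∂p.P, IsRegular ω ∧ p.IsSolventOn i x D (consPath a ω) ∧
      ∀ t ≤ (a.1 i).1, D t (consPath a ω) = d t := by
  filter_upwards [p.ae_ae_consPath hD.solvent, p.ae_ae_consPath hDd] with a h1 h2
  filter_upwards [h1, h2, p.ae_isRegular] with ω h1 h2 h3 using ⟨h3, h1, h2⟩

/-- The renewal equation, in the form that is compared pointwise in `a` with `oneStepPayoff_eq`. -/
theorem IsAdmissible.payoff_eq (hD : p.IsAdmissible i x D) (hd : IsDividendPath d)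
    (hDd : ∀ᵐ ω ∂p.P, ∀ t ≤ hold i ω 0, D t ω = d t) :
    p.payoff i x D = ∫⁻ a, (p.discounted (Ico 0 ((a.1 i).1 : ℝ)) d +
      ENNReal.ofReal (Real.exp (-p.δ * (a.1 i).1)) * if 0 ≤ p.nextSurplus i x d a then
        p.payoff (nextPhase i a) (p.nextSurplus i x d a).toNNReal (residual D i a)
        else 0) ∂p.stepLaw := by
  rw [payoff_eq_lintegral, p.lintegral_P hD.aemeasurable_paidBeforeRuin]
  refine lintegral_congr_ae ?_
  filter_upwards [hD.ae_split hDd] with a ha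
  refine (lintegral_congr_ae (ha.mono fun ω hω =>
    paidBeforeRuin_consPath hω.1 hω.2.1 (hD.path _) hd hω.2.2)).trans ?_
  rw [lintegral_add_left measurable_const,
    lintegral_const_mul' _ _ ENNReal.ofReal_ne_top, lintegral_const, measure_univ, mul_one]
  congr 2
  split_ifs
  · rfl
  · simp

/-- The strategy after the first sojourn is admissible. -/
theorem IsAdmissible.ae_isAdmissible_residual (hD : p.IsAdmissible i x D)
    (hDd : ∀ᵐ ω ∂p.P, ∀ t ≤ hold i ω 0, D t ω = d t) :
    ∀ᵐ a ∂p.stepLaw, 0 ≤ p.nextSurplus i x d a → p.IsAdmissible (nextPhase i a)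
      (p.nextSurplus i x d a).toNNReal (residual D i a) := by
  -- Only grid times are treated here, so that the exceptional sets of `a` stay countable in number;
  -- other times are left limits.
  have hm : ∀ᵐ a ∂p.stepLaw, ∀ m k : ℕ,
      Measurable[p.completed (nextPhase i a) ((k : ℝ≥0) / (m + 1) - (a.1 i).1)]
        fun ω => D ((k : ℝ≥0) / (m + 1)) (consPath a ω) :=
    ae_all_iff.2 fun m => ae_all_iff.2 fun k =>
      p.ae_measurable_consPath (hD.measurable_completed _)
  filter_upwards [hm, hD.ae_split hDd] with a hma ha hy
  have had : ∀ t, Measurable[p.completed (nextPhase i a) t]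
      fun ω => D ((a.1 i).1 + t) (consPath a ω) := by
    intro t
    let := p.completed (nextPhase i a) t
    have ht := tendsto_ceil_pred_div ((a.1 i).1 + t)
    refine measurable_of_tendsto_metrizable (f := fun (m : ℕ) ω =>
      D (((⌈((a.1 i).1 + t) * (m + 1)⌉₊ - 1 : ℕ) : ℝ≥0) / (m + 1)) (consPath a ω))
      (fun m => (hma m _).mono (p.completed_mono _ ?_) le_rfl)
      (tendsto_pi_nhds.2 fun ω => (hD.leftContinuous _ _).tendsto.comp ht)
    rw [tsub_le_iff_left, div_le_iff₀ (by positivity)]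
    rcases Nat.eq_zero_or_pos ⌈((a.1 i).1 + t) * (m + 1)⌉₊ with h | h
    · simp [h]
    · exact (Nat.lt_ceil.1 (Nat.sub_lt h one_pos)).le
  refine IsAdmissible.of_adapted (fun t => ?_) (fun ω => (hD.path _).shift _) ?_
  · have h0 := had 0
    rw [add_zero] at h0
    let := p.completed (nextPhase i a) t
    exact (had t).sub (h0.mono (p.completed_mono _ (zero_le (a := t))) le_rfl)
  · filter_upwards [ha] with ω ⟨hω, hs, hd⟩ t ht
    have he := surplus_consPath_add' (p := p) hω.nonexplosive (hd _ le_rfl) hy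
    rw [← he] at ht
    obtain ⟨s, hst, hcl, hneg⟩ := hs _ ht
    -- The surplus after the first jump is nonnegative, so the ruinous claim belongs to the shifted
    -- path.
    have h0 : s ≠ (a.1 i).1 := by
      rintro rfl
      have h1 := he 0
      rw [add_zero] at h1
      rw [h1, surplus, reserve, aggregateClaims_of_lt (hω.hold_pos 0 _)] at hneg
      simp only [residual, add_zero, sub_self, NNReal.coe_zero, mul_zero, sub_zero] at hneg
      exact absurd hneg (not_lt.2 (NNReal.coe_nonneg _))
    obtain ⟨u, rfl, hu⟩ := hcl.of_consPath.resolve_left h0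
    exact ⟨u, le_of_add_le_add_left hst, hu, by rwa [← he]⟩

end admissible

end RiskParams

theorem measurable_extendZero {w : ℝ≥0 → ℝ≥0∞} (hw : Measurable w) : Measurable (extendZero w) :=
  Measurable.ite measurableSet_Ici (hw.comp measurable_real_toNNReal) measurable_const

namespace RiskParams

variable {n : ℕ} (p : RiskParams n)

/-! ### The one-step payoff in terms of the first step noise -/

theorem measurable_terminal {W : Fin n → ℝ≥0 → ℝ≥0∞} (hW : ∀ j, Measurable (W j))
    (e : Fin (n + 1)) : Measurable (p.terminal W e) := by
  have := isProbabilityMeasure_expLaw p.β_pos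
  induction e using Fin.lastCases with
  | last =>
    simp only [terminal, Fin.lastCases_last]
    refine Finset.measurable_sum _ fun j _ => Measurable.const_mul ?_ _
    refine Measurable.lintegral_prod_right'
      (f := fun q : ℝ × ℝ≥0 => extendZero (W j) (q.1 - q.2)) ?_
    exact (measurable_extendZero (hW j)).comp (by fun_prop)
  | cast j =>
    simp only [terminal, Fin.lastCases_castSucc]
    exact measurable_extendZero (hW j)

theorem measurable_discounted_Ico {d : ℝ≥0 → ℝ} (hd : IsDividendPath d) :
    Measurable fun τ : ℝ≥0 => p.discounted (Ico 0 (τ : ℝ)) d := by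
  have := isProbabilityMeasure_expLaw p.δ_pos
  simp_rw [p.discounted_Ico hd]
  refine Measurable.lintegral_prod_right'
    (f := fun q : ℝ≥0 × ℝ≥0 => ENNReal.ofReal (d (min q.2 q.1))) ?_
  exact (hd.measurable.comp (measurable_snd.min measurable_fst)).ennreal_ofReal

theorem measurable_nextPhase (i : Fin n) : Measurable (nextPhase i) :=
  (measurable_of_countable fun q : Fin n × Fin (n + 1) =>
    Fin.lastCases (motive := fun _ => Fin n) q.1 (fun j => j) q.2).comp
      (measurable_snd.fst.prodMk ((measurable_pi_apply i).comp measurable_fst).snd)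

theorem measurable_firstClaim (i : Fin n) : Measurable (firstClaim i) :=
  Measurable.ite (((measurable_pi_apply i).comp measurable_fst).snd (measurableSet_singleton _))
    measurable_snd.snd.coe_nnreal_real measurable_const

theorem measurable_nextSurplus (i : Fin n) (x : ℝ≥0) {d : ℝ≥0 → ℝ} (hd : Measurable d) :
    Measurable (p.nextSurplus i x d) := by
  have h : Measurable fun a : StepNoise n => (a.1 i).1 :=
    ((measurable_pi_apply i).comp measurable_fst).fst
  exact ((measurable_const.add (h.coe_nnreal_real.const_mul _)).sub (hd.comp h)).sub
    (measurable_firstClaim i)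

theorem measurable_extendZero_next (i : Fin n) (x : ℝ≥0) {d : ℝ≥0 → ℝ} (hd : Measurable d)
    {W : Fin n → ℝ≥0 → ℝ≥0∞} (hW : ∀ j, Measurable (W j)) :
    Measurable fun a => extendZero (W (nextPhase i a)) (p.nextSurplus i x d a) :=
  measurable_discrete_app (g := fun a j => extendZero (W j) (p.nextSurplus i x d a))
    (measurable_nextPhase i) fun j =>
      (measurable_extendZero (hW j)).comp (p.measurable_nextSurplus i x hd)

/-- Averaging over the restart phase and the claim size produces `W_{n+1}` at a claim; at any other
jump these two variables play no role. -/
theorem lintegral_extendZero_next (i : Fin n) (x : ℝ≥0) (d : ℝ≥0 → ℝ)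
    {W : Fin n → ℝ≥0 → ℝ≥0∞} (hW : ∀ j, Measurable (W j)) (h : Fin n → ℝ≥0 × Fin (n + 1)) :
    ∫⁻ b, extendZero (W (nextPhase i (h, b))) (p.nextSurplus i x d (h, b))
        ∂(discreteLaw p.init).prod (expLaw p.β) =
      p.terminal W (h i).2 (x + p.c * (h i).1 - d (h i).1) := by
  have h3 := isProbabilityMeasure_discreteLaw p.init_nonneg p.init_sum
  have h4 := isProbabilityMeasure_expLaw p.β_pos
  rcases Fin.eq_castSucc_or_eq_last (h i).2 with ⟨j, hj⟩ | hl
  · simp only [nextPhase, nextSurplus, firstClaim, hj, Fin.lastCases_castSucc, terminal,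
      Fin.castSucc_ne_last, if_false, sub_zero, lintegral_const, measure_univ, mul_one]
  · simp only [nextPhase, nextSurplus, firstClaim, hl, Fin.lastCases_last, terminal, if_true]
    rw [lintegral_prod, lintegral_discreteLaw]
    refine Measurable.aemeasurable ?_
    exact measurable_discrete_app (f := fun b : Fin n × ℝ≥0 => b.1) (g := fun b j =>
      extendZero (W j) (x + p.c * (h i).1 - d (h i).1 - b.2)) measurable_fst fun j =>
        (measurable_extendZero (hW j)).comp (by fun_prop)

variable {p} in
-- Undoing the average inside `terminal` expresses the one-step payoff through the surplus after the
-- claim, as in `IsAdmissible.payoff_eq`.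
theorem oneStepPayoff_eq {i : Fin n} {x : ℝ≥0} {D : DividendProcess n}
    (hpath : ∀ ω, IsDividendPath fun t => D t ω) {d : ℝ≥0 → ℝ} (hd : IsDividendPath d)
    (hDd : ∀ᵐ ω ∂p.P, ∀ t ≤ hold i ω 0, D t ω = d t) {W : Fin n → ℝ≥0 → ℝ≥0∞}
    (hW : ∀ j, Measurable (W j)) :
    p.oneStepPayoff W i x D = ∫⁻ a, (p.discounted (Ico 0 ((a.1 i).1 : ℝ)) d +
      ENNReal.ofReal (Real.exp (-p.δ * (a.1 i).1)) *
        extendZero (W (nextPhase i a)) (p.nextSurplus i x d a)) ∂p.stepLaw := by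
  have h1 := fun i => isProbabilityMeasure_expLaw (p.rate_pos i)
  have h2 := fun i => isProbabilityMeasure_discreteLaw (p.jumpProb_nonneg i) (p.jumpProb_sum i)
  have h3 := isProbabilityMeasure_discreteLaw p.init_nonneg p.init_sum
  have h4 := isProbabilityMeasure_expLaw p.β_pos
  set f : (Fin n → ℝ≥0 × Fin (n + 1)) → ℝ≥0∞ := fun h =>
    p.discounted (Ico 0 ((h i).1 : ℝ)) d + ENNReal.ofReal (Real.exp (-p.δ * (h i).1)) *
      p.terminal W (h i).2 (x + p.c * (h i).1 - d (h i).1) with hf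
  have hm1 : Measurable fun h : Fin n → ℝ≥0 × Fin (n + 1) => (h i).1 :=
    (measurable_pi_apply i).fst
  have hme : Measurable fun h : Fin n → ℝ≥0 × Fin (n + 1) =>
      ENNReal.ofReal (Real.exp (-p.δ * (h i).1)) :=
    (Real.measurable_exp.comp (hm1.coe_nnreal_real.const_mul _)).ennreal_ofReal
  have hmd : Measurable fun h : Fin n → ℝ≥0 × Fin (n + 1) =>
      p.discounted (Ico 0 ((h i).1 : ℝ)) d := (p.measurable_discounted_Ico hd).comp hm1
  have hfm : Measurable f := by
    refine hmd.add (hme.mul ?_)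
    exact measurable_discrete_app (f := fun h : Fin n → ℝ≥0 × Fin (n + 1) => (h i).2)
      (g := fun h e => p.terminal W e (x + p.c * (h i).1 - d (h i).1))
      (measurable_pi_apply i).snd fun e => (p.measurable_terminal hW e).comp
        ((measurable_const.add (hm1.coe_nnreal_real.const_mul _)).sub (hd.measurable.comp hm1))
  have e1 : p.oneStepPayoff W i x D = ∫⁻ ω, f (ω 0).1 ∂p.P := by
    refine lintegral_congr_ae ?_
    filter_upwards [hDd] with ω hω
    rw [jumpTime_one, discounted_congr (hpath ω) hd hω, hω _ le_rfl]
    rfl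
  have e2 : ∫⁻ ω, f (ω 0).1 ∂p.P = ∫⁻ a, f a.1 ∂p.stepLaw :=
    (measurePreserving_eval_infinitePi (fun _ : ℕ => p.stepLaw) 0).lintegral_comp
      (hfm.comp measurable_fst)
  rw [e1, e2, stepLaw, lintegral_prod (fun a : StepNoise n => f a.1)
    (hfm.comp measurable_fst).aemeasurable, lintegral_prod]
  · refine lintegral_congr fun h => ?_
    dsimp only
    rw [lintegral_const, measure_univ, mul_one, lintegral_add_left measurable_const,
      lintegral_const, measure_univ, mul_one, lintegral_const_mul' _ _ ENNReal.ofReal_ne_top,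
      p.lintegral_extendZero_next i x d hW]
  · exact ((hmd.comp measurable_fst).add ((hme.comp measurable_fst).mul
      (p.measurable_extendZero_next i x hd.measurable hW))).aemeasurable

/-! ### Bounds, monotonicity and measurability of the value function -/

variable {p} in
theorem IsAdmissible.payoff_le {i : Fin n} {x : ℝ≥0} {D : DividendProcess n}
    (hD : p.IsAdmissible i x D) : p.payoff i x D ≤ ENNReal.ofReal (x + p.c / p.δ) := by
  rw [payoff_eq_lintegral]
  refine (lintegral_mono (g := fun _ => ENNReal.ofReal (x + p.c / p.δ)) fun ω => ?_).trans
    (by simp)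
  refine p.discounted_le (hD.path ω) fun t ht => ?_
  by_contra hlt
  refine absurd ht (not_lt.2 (iInf₂_le t ?_))
  have := aggregateClaims_nonneg i t ω
  rw [surplus, reserve]
  linarith [not_le.1 hlt]

theorem value_le (i : Fin n) (x : ℝ≥0) : p.value i x ≤ ENNReal.ofReal (x + p.c / p.δ) :=
  iSup₂_le fun _ hD => IsAdmissible.payoff_le hD

theorem value_lt_top (i : Fin n) (x : ℝ≥0) : p.value i x < ⊤ :=
  (p.value_le i x).trans_lt ENNReal.ofReal_lt_top

theorem payoff_le_value {i : Fin n} {x : ℝ≥0} {D : DividendProcess n}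
    (hD : p.IsAdmissible i x D) : p.payoff i x D ≤ p.value i x :=
  le_iSup₂ (f := fun D (_ : D ∈ p.admissible i x) => p.payoff i x D) D hD

/-- The strategy that pays the lump sum `h` at time zero and then follows `D`. -/
def lumpSum (h : ℝ) (D : DividendProcess n) : DividendProcess n :=
  fun t ω => (if 0 < t then h else 0) + D t ω

theorem _root_.IsDividendPath.lumpSum {d : ℝ≥0 → ℝ} (hd : IsDividendPath d) {h : ℝ} (hh : 0 ≤ h) :
    IsDividendPath fun t => (if 0 < t then h else 0) + d t where
  mono s t hst := by
    refine add_le_add ?_ (hd.mono hst)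
    split_ifs with h1 h2
    · exact le_rfl
    · exact absurd (h1.trans_le hst) h2
    · exact hh
    · exact le_rfl
  leftCont t := by
    refine ContinuousWithinAt.add ?_ (hd.leftCont t)
    rcases eq_or_lt_of_le (zero_le (a := t)) with h0 | h0
    · rw [← h0]
      refine (continuousWithinAt_const (b := (0 : ℝ))).congr (fun s hs => ?_) (by simp)
      simp [le_antisymm (mem_Iic.1 hs) (zero_le (a := s))]
    · refine (continuousWithinAt_const (b := h)).congr_of_eventuallyEq ?_ (by simp [h0])
      filter_upwards [mem_nhdsWithin_of_mem_nhds (Ioi_mem_nhds h0)] with s hs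
      simp [mem_Ioi.1 hs]
  zero := by simp [hd.zero]

section lumpSum

variable {p} {i : Fin n} {s y : ℝ≥0} {D : DividendProcess n} {ω : PathSpace n}

theorem surplus_lumpSum {t : ℝ≥0} (ht : 0 < t) :
    p.surplus i y (lumpSum (y - s) D) t ω = p.surplus i s D t ω := by
  simp only [surplus, reserve, lumpSum, if_pos ht]
  ring

theorem surplus_lumpSum_neg_iff (hω : IsRegular ω) (hD : D 0 ω = 0) (t : ℝ≥0) :
    p.surplus i y (lumpSum (y - s) D) t ω < 0 ↔ p.surplus i s D t ω < 0 := by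
  rcases eq_or_lt_of_le (zero_le (a := t)) with h0 | h0
  · rw [← h0]
    simp [surplus, reserve, lumpSum, aggregateClaims_of_lt (hω.hold_pos 0 i), hD]
  · rw [surplus_lumpSum h0]

theorem IsSolventOn.lumpSum (h : p.IsSolventOn i s D ω) (hω : IsRegular ω) (hD : D 0 ω = 0) :
    p.IsSolventOn i y (lumpSum (y - s) D) ω := by
  intro t ht
  rw [surplus_lumpSum_neg_iff hω hD] at ht
  obtain ⟨u, hu, hcl, hneg⟩ := h t ht
  exact ⟨u, hu, hcl, (surplus_lumpSum_neg_iff hω hD u).2 hneg⟩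

theorem IsAdmissible.lumpSum (hD : p.IsAdmissible i s D) (h : s ≤ y) :
    p.IsAdmissible i y (lumpSum (y - s) D) := by
  refine IsAdmissible.of_adapted (fun t => ?_) (fun ω => (hD.path ω).lumpSum ?_) ?_
  · let := p.completed i t
    exact measurable_const.add (hD.measurable_completed t)
  · exact sub_nonneg.2 (by exact_mod_cast h)
  · filter_upwards [hD.solvent, p.ae_isRegular] with ω h1 h2
    exact IsSolventOn.lumpSum h1 h2 (hD.zero ω)

/-- After time zero both surpluses coincide, so ruin occurs at the same time, while `y - s` more has
been paid. -/
theorem IsAdmissible.payoff_le_lumpSum (hD : p.IsAdmissible i s D) (h : s ≤ y) :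
    p.payoff i s D ≤ p.payoff i y (RiskParams.lumpSum (y - s) D) := by
  have h0 : (0 : ℝ) ≤ y - s := sub_nonneg.2 (by exact_mod_cast h)
  rw [payoff_eq_lintegral, payoff_eq_lintegral]
  refine lintegral_mono_ae ?_
  filter_upwards [p.ae_isRegular] with ω hω
  have hl : IsDividendPath fun t => RiskParams.lumpSum (y - s) D t ω := (hD.path ω).lumpSum h0
  rw [paidBeforeRuin, paidBeforeRuin, p.discounted_eq (hD.path ω), p.discounted_eq hl]
  have : p.ruinTime i y (RiskParams.lumpSum (y - s) D) ω = p.ruinTime i s D ω := by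
    simp only [ruinTime, surplus_lumpSum_neg_iff hω (hD.zero ω)]
  rw [this]
  refine lintegral_mono fun u => ENNReal.ofReal_le_ofReal ?_
  rw [RiskParams.lumpSum, le_add_iff_nonneg_left]
  split_ifs
  · exact h0
  · exact le_rfl

end lumpSum

/-- This yields Borel measurability of the value and the countable selection of near-optimal
strategies. -/
theorem value_mono (i : Fin n) : Monotone (p.value i) := fun _ _ h =>
  iSup₂_le fun _ hD => (IsAdmissible.payoff_le_lumpSum hD h).trans
    (p.payoff_le_value (IsAdmissible.lumpSum hD h))

theorem measurable_value (i : Fin n) : Measurable (p.value i) := (p.value_mono i).measurable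

/-! ### The value function is a subsolution -/

/-- The residual strategy is admissible for almost every first step noise, so its payoff is at most
the value of the new state. -/
theorem value_le_oneStepValue (i : Fin n) (x : ℝ≥0) :
    p.value i x ≤ p.oneStepValue p.value i x := by
  refine iSup₂_le fun D (hD : p.IsAdmissible i x D) => ?_
  refine le_trans ?_ (le_iSup₂ (f := fun D (_ : D ∈ p.admissible i x) =>
    p.oneStepPayoff p.value i x D) D hD)
  obtain ⟨d, hd, -, hDd⟩ := hD.exists_path
  rw [hD.payoff_eq hd hDd, oneStepPayoff_eq hD.path hd hDd p.measurable_value]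
  refine lintegral_mono_ae ?_
  filter_upwards [hD.ae_isAdmissible_residual hDd] with a ha
  gcongr
  rw [extendZero]
  split_ifs with hy
  · exact p.payoff_le_value (ha hy)
  · exact le_rfl

end RiskParams

/-- A monotone function is approximated from the left, up to `ε`, by its values on a countable
set. -/
theorem Monotone.exists_seq_le_add {g : ℝ≥0 → ℝ} (hg : Monotone g) {ε : ℝ} (hε : 0 < ε) :
    ∃ s : ℕ → ℝ≥0, ∀ y, ∃ k, s k ≤ y ∧ g y ≤ g (s k) + ε := by
  obtain ⟨S, hSc, hSd⟩ := TopologicalSpace.exists_countable_dense ℝ≥0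
  have hmono : Monotone fun y => ⌊g y / ε⌋ := fun a b hab =>
    Int.floor_le_floor (div_le_div_of_nonneg_right (hg hab) hε.le)
  -- On a level set of `⌊g / ε⌋` the function varies by less than `ε`. Each point of the level set
  -- is its infimum or has a point of `S` below it in the same level set, so `S` with all these
  -- infima suffices.
  have hc : (S ∪ range fun m : ℤ => sInf {y | ⌊g y / ε⌋ = m}).Countable :=
    hSc.union (countable_range _)
  obtain ⟨s, hs⟩ := hc.exists_eq_range ⟨_, Or.inr (mem_range_self 0)⟩
  have key : ∀ q y, q ≤ y → ⌊g q / ε⌋ = ⌊g y / ε⌋ → g y ≤ g q + ε := by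
    intro q y _ h
    have h1 := Int.floor_le (g q / ε)
    have h2 := Int.lt_floor_add_one (g y / ε)
    rw [← h] at h2
    rw [le_div_iff₀ hε] at h1
    rw [div_lt_iff₀ hε] at h2
    linarith
  refine ⟨s, fun y => ?_⟩
  suffices h : ∃ q ∈ range s, q ≤ y ∧ ⌊g q / ε⌋ = ⌊g y / ε⌋ by
    obtain ⟨_, ⟨k, rfl⟩, h1, h2⟩ := h
    exact ⟨k, h1, key _ _ h1 h2⟩
  rw [← hs]
  have hy : y ∈ {z | ⌊g z / ε⌋ = ⌊g y / ε⌋} := rfl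
  rcases eq_or_lt_of_le (csInf_le (OrderBot.bddBelow _) hy) with h | h
  · exact ⟨y, Or.inr ⟨_, h⟩, le_rfl, rfl⟩
  · obtain ⟨y', hy', hlt⟩ := exists_lt_of_csInf_lt ⟨y, hy⟩ h
    obtain ⟨q, hq, h1, h2⟩ := hSd.exists_between hlt
    exact ⟨q, Or.inl hq, h2.le, le_antisymm (hmono h2.le) (hy'.symm.trans_le (hmono h1.le))⟩

theorem IsDividendPath.paste {d e : ℝ≥0 → ℝ} (hd : IsDividendPath d) (he : IsDividendPath e)
    (τ : ℝ≥0) : IsDividendPath fun t => d (min t τ) + e (t - τ) where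
  mono s t hst := add_le_add (hd.mono (min_le_min_right τ hst)) (he.mono (tsub_le_tsub_right hst τ))
  leftCont t := by
    refine ContinuousWithinAt.add ?_ ?_
    · exact (hd.leftCont (min t τ)).comp (f := fun t => min t τ)
        (Continuous.continuousWithinAt (by fun_prop)) fun s hs => min_le_min_right τ (mem_Iic.1 hs)
    · exact (he.leftCont (t - τ)).comp (f := fun t => t - τ)
        (Continuous.continuousWithinAt (by fun_prop)) fun s hs => tsub_le_tsub_right (mem_Iic.1 hs) τ
  zero := by simp [hd.zero, he.zero]

theorem isDividendPath_zero : IsDividendPath fun _ => 0 :=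
  ⟨monotone_const, fun _ => continuousWithinAt_const, rfl⟩

namespace RiskParams

variable {n : ℕ} (p : RiskParams n)

/-! ### Paying nothing is admissible -/

theorem IsRegular.jumpTime_strictMono {ω : PathSpace n} (hω : IsRegular ω) (i : Fin n) :
    StrictMono (jumpTime i ω) := by
  refine strictMono_nat_of_lt_succ fun k => ?_
  rw [jumpTime, jumpTime, Finset.sum_range_succ]
  exact lt_add_of_pos_right _ (hω.hold_pos k _)

theorem IsRegular.jumpCount_jumpTime {ω : PathSpace n} (hω : IsRegular ω) (i : Fin n) (k : ℕ) :
    jumpCount i (jumpTime i ω k) ω = k := by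
  refine le_antisymm (Nat.sInf_le (hω.jumpTime_strictMono i k.lt_succ_self)) ?_
  have h := lt_jumpTime_jumpCount hω.nonexplosive i (jumpTime i ω k)
  exact Nat.lt_succ_iff.1 ((hω.jumpTime_strictMono i).lt_iff_lt.1 h)

theorem jumpTime_le_of_lt_jumpCount {ω : PathSpace n} {i : Fin n} {t : ℝ≥0} {k : ℕ}
    (h : k < jumpCount i t ω) : jumpTime i ω (k + 1) ≤ t :=
  not_lt.1 (Nat.notMem_of_lt_sInf h)

/-- Between claims the surplus only grows; if it is negative at `t`, it was already negative at the
last claim before or at `t`. -/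
theorem isAdmissible_zero (i : Fin n) (x : ℝ≥0) : p.IsAdmissible i x fun _ _ => 0 := by
  refine IsAdmissible.of_adapted (fun t => ?_) (fun ω => isDividendPath_zero) ?_
  · let := p.completed i t
    exact measurable_const
  filter_upwards [p.ae_isRegular] with ω hω t ht
  have hc := p.c_pos
  set T := (Finset.range (jumpCount i t ω)).filter fun k => entered i ω k = Fin.last n with hT
  have hne : T.Nonempty := by
    by_contra hcon
    have h0 : aggregateClaims i t ω = 0 := Finset.sum_eq_zero fun k hk => if_neg fun hl => by
      have : k ∈ T := Finset.mem_filter.2 ⟨hk, hl⟩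
      exact hcon ⟨k, this⟩
    rw [surplus, reserve, h0] at ht
    have : 0 ≤ (x : ℝ) + p.c * t := by positivity
    linarith
  obtain ⟨h1, h2⟩ := Finset.mem_filter.1 (T.max'_mem hne)
  set k := T.max' hne
  have hle := jumpTime_le_of_lt_jumpCount (Finset.mem_range.1 h1)
  refine ⟨jumpTime i ω (k + 1), hle, ⟨k, rfl, h2⟩, ?_⟩
  have hagg : aggregateClaims i (jumpTime i ω (k + 1)) ω = aggregateClaims i t ω := by
    rw [aggregateClaims, aggregateClaims, hω.jumpCount_jumpTime]
    refine Finset.sum_subset (Finset.range_mono (Finset.mem_range.1 h1)) fun m hm hm' => ?_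
    refine if_neg fun hl => ?_
    have := T.le_max' m (Finset.mem_filter.2 ⟨hm, hl⟩)
    exact hm' (Finset.mem_range.2 (Nat.lt_succ_of_le this))
  rw [surplus, reserve, hagg]
  rw [surplus, reserve] at ht
  have : (jumpTime i ω (k + 1) : ℝ) ≤ t := by exact_mod_cast hle
  have := mul_le_mul_of_nonneg_left this hc.le
  linarith

theorem exists_payoff_add_ge (i : Fin n) (x : ℝ≥0) {ε : ℝ≥0∞} (hε : ε ≠ 0) :
    ∃ D, p.IsAdmissible i x D ∧ p.value i x ≤ p.payoff i x D + ε := by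
  rcases eq_or_ne (p.value i x) 0 with h0 | h0
  · exact ⟨_, p.isAdmissible_zero i x, by simp [h0]⟩
  · have h := ENNReal.sub_lt_self (p.value_lt_top i x).ne h0 hε
    conv_rhs at h => rw [value]
    obtain ⟨D, hD⟩ := lt_iSup_iff.1 h
    obtain ⟨hD1, hD2⟩ := lt_iSup_iff.1 hD
    exact ⟨D, hD1, tsub_le_iff_right.1 hD2.le⟩

/-! ### Pasting strategies at the first jump -/

/-- Strategies for the shifted path, chosen by the data of the first jump and started at the first
jump time, are adapted. -/
theorem measurable_delayed {i : Fin n} {t : ℝ≥0} {K : PathSpace n → ℕ}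
    (hK : Measurable[p.completed i t] K) {E : Fin n → ℕ → DividendProcess n}
    (hE : ∀ j k u, Measurable[p.completed j u] (E j k u))
    (hlc : ∀ j k ω u, ContinuousWithinAt (fun u => E j k u ω) (Iic u) u) :
    Measurable[p.completed i t] fun ω => if hold i ω 0 ≤ t then
      E (nextPhase i (ω 0)) (K ω) (t - hold i ω 0) (shiftPath ω) else 0 := by
  have hτ := p.measurableSet_hold_le i t
  have hmin := p.measurable_min_hold i t
  let := p.completed i t
  have hL : ∀ m : ℕ, Measurable[p.completed i t] fun ω : PathSpace n =>
      ⌈(t - min (hold i ω 0) t) * (m + 1)⌉₊ - 1 := fun m =>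
    (measurable_of_countable fun k : ℕ => k - 1).comp
      (Nat.measurable_ceil.comp ((measurable_const.sub hmin).mul_const _))
  -- The time since the jump is moved down to the grid. Splitting by new phase `j`, strategy number
  -- `k` and grid index `l` leaves events covered by `measurableSet_inter_shiftPath`.
  refine measurable_of_tendsto_metrizable (f := fun (m : ℕ) ω => if hold i ω 0 ≤ t then
      E (nextPhase i (ω 0)) (K ω)
        (((⌈(t - min (hold i ω 0) t) * (m + 1)⌉₊ - 1 : ℕ) : ℝ≥0) / (m + 1)) (shiftPath ω)
      else 0) (fun m B hB => ?_) (tendsto_pi_nhds.2 fun ω => ?_)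
  · have : ((fun ω => if hold i ω 0 ≤ t then E (nextPhase i (ω 0)) (K ω)
        (((⌈(t - min (hold i ω 0) t) * (m + 1)⌉₊ - 1 : ℕ) : ℝ≥0) / (m + 1)) (shiftPath ω)
        else 0) ⁻¹' B) = ({ω | hold i ω 0 ≤ t}ᶜ ∩ {_ω | (0 : ℝ) ∈ B}) ∪
      ⋃ (j : Fin n) (k : ℕ) (l : ℕ), ((K ⁻¹' {k}) ∩
        ((fun ω => ⌈(t - min (hold i ω 0) t) * (m + 1)⌉₊ - 1) ⁻¹' {l})) ∩
        ({ω | hold i ω 0 + (l : ℝ≥0) / (m + 1) ≤ t ∧ nextPhase i (ω 0) = j} ∩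
          shiftPath ⁻¹' (E j k ((l : ℝ≥0) / (m + 1)) ⁻¹' B)) := by
      ext ω
      simp only [mem_preimage, mem_union, mem_inter_iff, mem_compl_iff, mem_ofPred_eq, mem_iUnion,
        mem_singleton_iff]
      by_cases h : hold i ω 0 ≤ t
      · simp only [h, not_true_eq_false, false_and, false_or]
        constructor
        · intro hmem
          refine ⟨_, _, _, ⟨rfl, rfl⟩, ⟨?_, rfl⟩, hmem⟩
          rw [min_eq_left h, ← le_tsub_iff_left h, div_le_iff₀ (by positivity)]
          rcases Nat.eq_zero_or_pos ⌈(t - hold i ω 0) * (m + 1)⌉₊ with h' | h'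
          · simp [h']
          · exact (Nat.lt_ceil.1 (Nat.sub_lt h' one_pos)).le
        · rintro ⟨j, k, l, ⟨rfl, rfl⟩, ⟨-, rfl⟩, hmem⟩
          exact hmem
      · simp only [h, not_false_eq_true, true_and]
        refine ⟨Or.inl, fun hor => hor.resolve_right ?_⟩
        rintro ⟨j, k, l, -, ⟨hle, -⟩, -⟩
        exact h (le_self_add.trans hle)
    rw [this]
    refine (hτ.compl.inter (MeasurableSet.const _)).union (MeasurableSet.iUnion fun j =>
      MeasurableSet.iUnion fun k => MeasurableSet.iUnion fun l => MeasurableSet.inter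
        ((hK (measurableSet_singleton k)).inter (hL m (measurableSet_singleton l))) ?_)
    exact p.measurableSet_inter_shiftPath (hE j k _ hB)
  · by_cases h : hold i ω 0 ≤ t
    · simp only [if_pos h, min_eq_left h]
      exact (hlc _ _ _ _).tendsto.comp (tendsto_ceil_pred_div _)
    · simp only [if_neg h]
      exact tendsto_const_nhds

/-- The dividends paid after the first jump: from the surplus `y ≥ 0` after the jump, the surplus
is immediately reduced to `s j (K j y)`, where `j` is the new phase, and then the strategy with
the number `K j y` is followed. -/
def continuation (i : Fin n) (x : ℝ≥0) (d : ℝ≥0 → ℝ) (s : Fin n → ℕ → ℝ≥0)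
    (K : Fin n → ℝ≥0 → ℕ) (E : Fin n → ℕ → DividendProcess n) (a : StepNoise n) :
    DividendProcess n := fun t ω =>
  let j := nextPhase i a
  let y := (p.nextSurplus i x d a).toNNReal
  if 0 ≤ p.nextSurplus i x d a then lumpSum (y - s j (K j y)) (E j (K j y)) t ω else 0

/-- The strategy that pays `d` before the first jump and then the `continuation`. -/
def pasted (i : Fin n) (x : ℝ≥0) (d : ℝ≥0 → ℝ) (s : Fin n → ℕ → ℝ≥0)
    (K : Fin n → ℝ≥0 → ℕ) (E : Fin n → ℕ → DividendProcess n) : DividendProcess n := fun t ω =>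
  d (min t (hold i ω 0)) +
    p.continuation i x d s K E (ω 0) (t - hold i ω 0) (shiftPath ω)

section pasted

variable {p} {i : Fin n} {x : ℝ≥0} {d : ℝ≥0 → ℝ} {s : Fin n → ℕ → ℝ≥0}
  {K : Fin n → ℝ≥0 → ℕ} {E : Fin n → ℕ → DividendProcess n}

theorem isDividendPath_continuation (hs : ∀ j y, s j (K j y) ≤ y)
    (hE : ∀ j k, p.IsAdmissible j (s j k) (E j k)) (a : StepNoise n) (ω : PathSpace n) :
    IsDividendPath fun t => p.continuation i x d s K E a t ω := by
  by_cases h : 0 ≤ p.nextSurplus i x d a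
  · simp only [continuation, if_pos h]
    exact ((hE _ _).path ω).lumpSum (sub_nonneg.2 (by exact_mod_cast hs _ _))
  · simp only [continuation, if_neg h]
    exact isDividendPath_zero

theorem isDividendPath_pasted (hd : IsDividendPath d) (hs : ∀ j y, s j (K j y) ≤ y)
    (hE : ∀ j k, p.IsAdmissible j (s j k) (E j k)) (ω : PathSpace n) :
    IsDividendPath fun t => p.pasted i x d s K E t ω :=
  hd.paste (isDividendPath_continuation hs hE (ω 0) (shiftPath ω)) _

theorem pasted_of_le (hs : ∀ j y, s j (K j y) ≤ y) (hE : ∀ j k, p.IsAdmissible j (s j k) (E j k))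
    {t : ℝ≥0} {ω : PathSpace n} (ht : t ≤ hold i ω 0) : p.pasted i x d s K E t ω = d t := by
  have h0 := (isDividendPath_continuation (i := i) (x := x) (d := d) hs hE (ω 0)
    (shiftPath ω)).zero
  rw [pasted, min_eq_left ht, tsub_eq_zero_of_le ht, h0, add_zero]

theorem residual_pasted (hs : ∀ j y, s j (K j y) ≤ y)
    (hE : ∀ j k, p.IsAdmissible j (s j k) (E j k)) (a : StepNoise n) :
    residual (p.pasted i x d s K E) i a = p.continuation i x d s K E a := by
  ext t ω
  rw [residual, pasted_of_le hs hE (ω := consPath a ω) (t := (a.1 i).1) le_rfl, pasted,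
    hold_consPath_zero, shiftPath_consPath, min_eq_right le_self_add, add_tsub_cancel_left,
    add_tsub_cancel_left]
  rfl

/-- Adaptedness holds because the choice of continuation uses only data known once the jump has
occurred. Solvency follows from `hdx` before the jump and from the chosen strategies after it; ruin
at the jump must come from a claim. -/
theorem isAdmissible_pasted (hd : IsDividendPath d) (hdx : ∀ t : ℝ≥0, d t ≤ x + p.c * t)
    (hs : ∀ j y, s j (K j y) ≤ y) (hK : ∀ j, Measurable (K j))
    (hE : ∀ j k, p.IsAdmissible j (s j k) (E j k)) :
    p.IsAdmissible i x (p.pasted i x d s K E) := by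
  refine IsAdmissible.of_adapted (fun t => ?_) (isDividendPath_pasted hd hs hE) ?_
  · obtain ⟨Z, hZm, hZ⟩ := p.exists_measurable_firstJump i t
    have hmin := p.measurable_min_hold i t
    have hc1 : Measurable fun q : Fin n × ℝ≥0 => K q.1 q.2 :=
      measurable_discrete_app (g := fun (q : Fin n × ℝ≥0) j => K j q.2) measurable_fst
        fun j => (hK j).comp measurable_snd
    -- A quantity known at time `t` that is almost surely the surplus after the first jump whenever
    -- that jump occurs by `t`.
    let y : PathSpace n → ℝ := fun ω =>
      x + p.c * (min (hold i ω 0) t : ℝ≥0) - d (min (hold i ω 0) t) - (Z ω).2.2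
    have hy : Measurable[p.completed i t] y := by
      let := p.completed i t
      exact ((measurable_const.add (hmin.coe_nnreal_real.const_mul _)).sub
        (hd.measurable.comp hmin)).sub hZm.snd.snd
    let k : PathSpace n → ℕ := fun ω => K (Z ω).1 (y ω).toNNReal
    have hk : Measurable[p.completed i t] k := by
      let := p.completed i t
      exact hc1.comp (hZm.fst.prodMk hy.real_toNNReal)
    have hdel := p.measurable_delayed hk (fun j k u => (hE j k).measurable_completed u)
      fun j k ω u => (hE j k).leftContinuous ω u
    -- The condition `min (hold i ω 0) t < t` expresses `hold i ω 0 < t` through a variable known at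
    -- `t`. A jump exactly at `t` adds nothing, since the continuation starts at `0`.
    refine p.measurable_completed_congr (g := fun ω => d (min (hold i ω 0) t) +
      if min (hold i ω 0) t < t ∧ 0 ≤ y ω then ((y ω).toNNReal - s (Z ω).1 (k ω) : ℝ) +
        if hold i ω 0 ≤ t then E (nextPhase i (ω 0)) (k ω) (t - hold i ω 0) (shiftPath ω) else 0
      else 0) ?_ ?_
    · let := p.completed i t
      refine (hd.measurable.comp hmin).add (Measurable.ite ?_ (Measurable.add ?_ hdel)
        measurable_const)
      · exact (measurableSet_lt hmin measurable_const).inter (measurableSet_le measurable_const hy)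
      · refine hy.real_toNNReal.coe_nnreal_real.sub (Measurable.coe_nnreal_real ?_)
        exact (measurable_of_countable fun q : Fin n × ℕ => s q.1 q.2).comp (hZm.fst.prodMk hk)
    · filter_upwards [hZ] with ω hω
      rw [pasted, min_comm]
      congr 1
      rcases lt_or_ge (hold i ω 0) t with h | h
      · have hye : p.nextSurplus i x d (ω 0) = y ω := by
          simp only [y, hω h.le, min_eq_left h.le]
          rfl
        have hj : (Z ω).1 = nextPhase i (ω 0) := by rw [hω h.le]
        simp only [continuation, lumpSum, hye, min_eq_left h.le, h, true_and, if_true, h.le, k, hj,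
          tsub_pos_of_lt h]
      · have h0 := (isDividendPath_continuation (i := i) (x := x) (d := d) hs hE (ω 0)
          (shiftPath ω)).zero
        rw [tsub_eq_zero_of_le h, h0, min_eq_right h, if_neg (by simp)]
  · have hsolv : ∀ᵐ ω ∂p.P, ∀ j k, p.IsSolventOn j (s j k) (E j k) (shiftPath ω) :=
      p.ae_shiftPath (ae_all_iff.2 fun j => ae_all_iff.2 fun k => (hE j k).solvent)
    filter_upwards [hsolv, p.ae_isRegular_shiftPath] with ω hω hreg t ht
    rcases lt_or_ge t (hold i ω 0) with h | h
    · rw [surplus, reserve, aggregateClaims_of_lt h, pasted_of_le hs hE h.le] at ht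
      linarith [hdx t]
    · obtain ⟨u, rfl⟩ := exists_add_of_le h
      have hdτ : p.pasted i x d s K E (hold i ω 0) ω = d (hold i ω 0) :=
        pasted_of_le hs hE le_rfl
      have hcons := consPath_shiftPath ω
      have hadd := surplus_consPath_add (p := p) (i := i) (x := x) (D := p.pasted i x d s K E)
        (d := d) (a := ω 0) hreg.nonexplosive (by rw [hcons]; exact hdτ)
      have hadd' := surplus_consPath_add' (p := p) (i := i) (x := x) (D := p.pasted i x d s K E)
        (d := d) (a := ω 0) hreg.nonexplosive (by rw [hcons]; exact hdτ)
      rw [hcons] at hadd hadd'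
      change ∀ t, p.surplus i x _ (hold i ω 0 + t) ω = _ at hadd
      change _ → ∀ t, p.surplus i x _ (hold i ω 0 + t) ω = _ at hadd'
      rw [residual_pasted hs hE] at hadd hadd'
      by_cases hy : 0 ≤ p.nextSurplus i x d (ω 0)
      · have hcont : p.continuation i x d s K E (ω 0) = lumpSum
            ((p.nextSurplus i x d (ω 0)).toNNReal - s (nextPhase i (ω 0))
              (K (nextPhase i (ω 0)) (p.nextSurplus i x d (ω 0)).toNNReal))
            (E (nextPhase i (ω 0)) (K (nextPhase i (ω 0)) (p.nextSurplus i x d (ω 0)).toNNReal)) := by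
          ext t ω
          simp only [continuation, if_pos hy]
        have hadd'' := hadd' hy
        rw [hcont] at hadd''
        rw [hadd''] at ht
        obtain ⟨v, hv, hcl, hneg⟩ := (hω _ _).lumpSum hreg ((hE _ _).zero _) u ht
        refine ⟨hold i ω 0 + v, by gcongr, ?_, by rwa [hadd'']⟩
        have := isClaimTime_consPath_add (i := i) (a := ω 0) hcl
        rwa [hcons] at this
      -- Ruin at the first jump: by `hdx` the surplus just before is nonnegative, so the jump is a
      -- claim.
      · refine ⟨hold i ω 0, le_self_add, ⟨0, jumpTime_one i ω, ?_⟩, ?_⟩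
        · by_contra hne
          refine hy ?_
          have : firstClaim i (ω 0) = 0 := if_neg hne
          rw [nextSurplus, this, sub_zero]
          exact sub_nonneg.2 (hdx _)
        · have h0 := hadd 0
          rw [add_zero] at h0
          rw [h0, aggregateClaims_of_lt (hreg.hold_pos 0 _),
            (isDividendPath_continuation hs hE _ _).zero]
          simpa using hy

end pasted

/-- Taking the least suitable index makes the choice measurable in `y`, so no general measurable
selection is required. -/
theorem exists_selection {ε : ℝ} (hε : 0 < ε) (j : Fin n) : ∃ (s : ℕ → ℝ≥0) (K : ℝ≥0 → ℕ),
    Measurable K ∧ ∀ y, s (K y) ≤ y ∧ p.value j y ≤ p.value j (s (K y)) + ENNReal.ofReal ε := by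
  have hmono : Monotone fun y => (p.value j y).toReal := fun a b h =>
    ENNReal.toReal_mono (p.value_lt_top j b).ne (p.value_mono j h)
  obtain ⟨s, hs⟩ := hmono.exists_seq_le_add hε
  have hs' : ∀ y, ∃ k, s k ≤ y ∧ p.value j y ≤ p.value j (s k) + ENNReal.ofReal ε := by
    intro y
    obtain ⟨k, h1, h2⟩ := hs y
    refine ⟨k, h1, ?_⟩
    rw [← ENNReal.ofReal_toReal (p.value_lt_top j y).ne,
      ← ENNReal.ofReal_toReal (p.value_lt_top j (s k)).ne,
      ← ENNReal.ofReal_add ENNReal.toReal_nonneg hε.le]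
    exact ENNReal.ofReal_le_ofReal h2
  classical
  exact ⟨s, fun y => Nat.find (hs' y), measurable_find hs' fun k =>
    (measurableSet_le measurable_const measurable_id).inter
      (measurableSet_le (p.measurable_value j) measurable_const), fun y => Nat.find_spec (hs' y)⟩

/-- The value function is a supersolution. -/
theorem oneStepValue_le_value (i : Fin n) (x : ℝ≥0) :
    p.oneStepValue p.value i x ≤ p.value i x := by
  refine iSup₂_le fun D (hD : p.IsAdmissible i x D) => ?_
  refine ENNReal.le_of_forall_pos_le_add fun ε hε _ => ?_
  -- One half of `ε` is spent on lowering the surplus to a selected level, the other on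
  -- near-optimality there; discounting does not enlarge the sum.
  have hε2 : (0 : ℝ) < ε / 2 := half_pos (by exact_mod_cast hε)
  have hε2' : ENNReal.ofReal (ε / 2) ≠ 0 := (ENNReal.ofReal_pos.2 hε2).ne'
  have hsum : ENNReal.ofReal (ε / 2) + ENNReal.ofReal (ε / 2) = ε := by
    rw [← ENNReal.ofReal_add hε2.le hε2.le, add_halves, ENNReal.ofReal_coe_nnreal]
  obtain ⟨d, hd, hdx, hDd⟩ := hD.exists_path
  choose s K hK hsK using p.exists_selection hε2
  choose E hE hEv using fun j k => p.exists_payoff_add_ge j (s j k) hε2'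
  have hs : ∀ j y, s j (K j y) ≤ y := fun j y => (hsK j y).1
  have hP : p.IsAdmissible i x (p.pasted i x d s K E) := isAdmissible_pasted hd hdx hs hK hE
  refine le_trans ?_ (add_le_add_left (p.payoff_le_value hP) _)
  rw [oneStepPayoff_eq hD.path hd hDd p.measurable_value, hP.payoff_eq hd
    (Eventually.of_forall fun ω t ht => pasted_of_le hs hE ht)]
  have hconst : (ε : ℝ≥0∞) = ∫⁻ _ : StepNoise n, (ε : ℝ≥0∞) ∂p.stepLaw := by simp
  rw [hconst, ← lintegral_add_right _ measurable_const]
  refine lintegral_mono fun a => ?_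
  rw [add_assoc]
  gcongr
  have hexp : ENNReal.ofReal (Real.exp (-p.δ * (a.1 i).1)) ≤ 1 := by
    rw [← ENNReal.ofReal_one]
    refine ENNReal.ofReal_le_ofReal (Real.exp_le_one_iff.2 ?_)
    rw [neg_mul]
    exact neg_nonpos.2 (mul_nonneg p.δ_pos.le (NNReal.coe_nonneg _))
  rw [extendZero, residual_pasted hs hE]
  split_ifs with hy
  · have hcont : p.continuation i x d s K E a = lumpSum
        ((p.nextSurplus i x d a).toNNReal - s (nextPhase i a)
          (K (nextPhase i a) (p.nextSurplus i x d a).toNNReal))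
        (E (nextPhase i a) (K (nextPhase i a) (p.nextSurplus i x d a).toNNReal)) := by
      ext t ω
      simp only [continuation, if_pos hy]
    have h1 : p.value (nextPhase i a) (p.nextSurplus i x d a).toNNReal ≤
        p.payoff (nextPhase i a) (p.nextSurplus i x d a).toNNReal
          (p.continuation i x d s K E a) + ε := by
      rw [hcont, ← hsum, ← add_assoc]
      refine (hsK _ _).2.trans (add_le_add_left ((hEv _ _).trans ?_) _)
      exact add_le_add_left ((hE _ _).payoff_le_lumpSum (hs _ _)) _
    calc _ ≤ ENNReal.ofReal (Real.exp (-p.δ * (a.1 i).1)) *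
          (p.payoff (nextPhase i a) (p.nextSurplus i x d a).toNNReal
            (p.continuation i x d s K E a) + ε) := by gcongr
      _ ≤ _ := by
        rw [mul_add]
        gcongr
        exact mul_le_of_le_one_left bot_le hexp
  · simp


/-! ### Discounting beats the growth of the surplus -/

theorem firstClaim_nonneg (i : Fin n) (a : StepNoise n) : 0 ≤ firstClaim i a := by
  rw [firstClaim]
  split_ifs <;> positivity

/-- With `A = x + 2c/δ`, one has `exp (δτ/2) * A ≥ (1 + δτ/2) * A ≥ A + cτ`: half of the discounting
absorbs the premium income, and the constant `2c/δ` is chosen for this. The other half remains as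
the contraction factor. -/
theorem exp_mul_add_le {i : Fin n} {x : ℝ≥0} {d : ℝ≥0 → ℝ} (hd : IsDividendPath d)
    {a : StepNoise n} {C u v : ℝ≥0∞} (h : v ≤ u + C * ENNReal.ofReal
      ((p.nextSurplus i x d a).toNNReal + 2 * p.c / p.δ)) (hy : 0 ≤ p.nextSurplus i x d a) :
    ENNReal.ofReal (Real.exp (-p.δ * (a.1 i).1)) * v ≤
      ENNReal.ofReal (Real.exp (-p.δ * (a.1 i).1)) * u +
        ENNReal.ofReal (Real.exp (-(p.δ / 2) * (a.1 i).1)) *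
          (C * ENNReal.ofReal (x + 2 * p.c / p.δ)) := by
  have hc := p.c_pos
  have hδ := p.δ_pos
  set τ := (a.1 i).1
  have key : ENNReal.ofReal (Real.exp (-p.δ * τ)) *
      ENNReal.ofReal ((p.nextSurplus i x d a).toNNReal + 2 * p.c / p.δ) ≤
      ENNReal.ofReal (Real.exp (-(p.δ / 2) * τ)) * ENNReal.ofReal (x + 2 * p.c / p.δ) := by
    rw [← ENNReal.ofReal_mul (Real.exp_pos _).le, ← ENNReal.ofReal_mul (Real.exp_pos _).le,
      Real.coe_toNNReal _ hy]
    refine ENNReal.ofReal_le_ofReal ?_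
    have h1 : p.nextSurplus i x d a ≤ x + p.c * τ := by
      have := hd.nonneg τ
      have := firstClaim_nonneg i a
      rw [nextSurplus]
      linarith
    have h2 : Real.exp (-p.δ * τ) = Real.exp (-(p.δ / 2) * τ) * Real.exp (-(p.δ / 2) * τ) := by
      rw [← Real.exp_add]
      congr 1
      ring
    have h3 : p.δ / 2 * τ + 1 ≤ Real.exp (p.δ / 2 * τ) := Real.add_one_le_exp _
    have h4 : Real.exp (-(p.δ / 2) * τ) * Real.exp (p.δ / 2 * τ) = 1 := by
      rw [← Real.exp_add]
      simp
    rw [h2, mul_assoc]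
    refine mul_le_mul_of_nonneg_left ?_ (Real.exp_pos _).le
    have h5 : p.nextSurplus i x d a + 2 * p.c / p.δ ≤
        Real.exp (p.δ / 2 * τ) * (x + 2 * p.c / p.δ) := by
      have h6 : (p.δ / 2 * τ + 1) * (x + 2 * p.c / p.δ) =
          x + p.c * τ + 2 * p.c / p.δ + p.δ / 2 * τ * x := by
        field_simp
        ring
      have h7 : 0 ≤ p.δ / 2 * τ * x := by positivity
      calc _ ≤ (p.δ / 2 * τ + 1) * (x + 2 * p.c / p.δ) := by linarith
        _ ≤ _ := by gcongr
    calc _ ≤ Real.exp (-(p.δ / 2) * τ) * (Real.exp (p.δ / 2 * τ) * (x + 2 * p.c / p.δ)) := by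
          gcongr
      _ = _ := by rw [← mul_assoc, h4, one_mul]
  calc _ ≤ ENNReal.ofReal (Real.exp (-p.δ * τ)) * (u + C * ENNReal.ofReal
        ((p.nextSurplus i x d a).toNNReal + 2 * p.c / p.δ)) := by gcongr
    _ = ENNReal.ofReal (Real.exp (-p.δ * τ)) * u + C * (ENNReal.ofReal (Real.exp (-p.δ * τ)) *
        ENNReal.ofReal ((p.nextSurplus i x d a).toNNReal + 2 * p.c / p.δ)) := by ring
    _ ≤ ENNReal.ofReal (Real.exp (-p.δ * τ)) * u + C * (ENNReal.ofReal
        (Real.exp (-(p.δ / 2) * τ)) * ENNReal.ofReal (x + 2 * p.c / p.δ)) := by gcongr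
    _ = _ := by ring

theorem value_le_two_mul (i : Fin n) (x : ℝ≥0) :
    p.value i x ≤ ENNReal.ofReal (x + 2 * p.c / p.δ) := by
  have := div_pos p.c_pos p.δ_pos
  refine (p.value_le i x).trans (ENNReal.ofReal_le_ofReal ?_)
  rw [mul_div_assoc]
  linarith

theorem measurable_exp_hold (i : Fin n) (θ : ℝ) :
    Measurable fun a : StepNoise n => ENNReal.ofReal (Real.exp (-θ * (a.1 i).1)) :=
  (Real.measurable_exp.comp (((measurable_pi_apply i).comp
    measurable_fst).fst.coe_nnreal_real.const_mul _)).ennreal_ofReal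

theorem lintegral_add_exp_le {i : Fin n} {r C : ℝ≥0∞} (hC : C ≠ ⊤)
    (hr : ∫⁻ a : StepNoise n, ENNReal.ofReal (Real.exp (-(p.δ / 2) * (a.1 i).1)) ∂p.stepLaw ≤ r)
    {f g : StepNoise n → ℝ≥0∞} (h : ∀ᵐ a ∂p.stepLaw,
      f a ≤ g a + ENNReal.ofReal (Real.exp (-(p.δ / 2) * (a.1 i).1)) * C) :
    ∫⁻ a, f a ∂p.stepLaw ≤ ∫⁻ a, g a ∂p.stepLaw + r * C := by
  refine (lintegral_mono_ae h).trans ?_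
  rw [lintegral_add_right _ ((measurable_exp_hold i _).mul_const _), lintegral_mul_const' _ _ hC]
  gcongr

theorem le_of_forall_le_add_pow {r A u v : ℝ≥0∞} (hr : r < 1) (hA : A ≠ ⊤)
    (h : ∀ k : ℕ, v ≤ u + r ^ k * A) : v ≤ u := by
  have ht := (ENNReal.Tendsto.mul_const (ENNReal.tendsto_pow_atTop_nhds_zero_of_lt_one hr)
    (Or.inr hA)).const_add u
  rw [zero_mul, add_zero] at ht
  exact ge_of_tendsto' ht h

/-! ### The least solution of the dynamic programming equation -/

theorem isSolution_value : p.IsSolution p.value :=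
  ⟨p.measurable_value, fun i x =>
    le_antisymm (p.value_le_oneStepValue i x) (p.oneStepValue_le_value i x)⟩

/-- The value function is the smallest solution of the dynamic programming equation. -/
theorem value_le_of_isSolution {W : Fin n → ℝ≥0 → ℝ≥0∞} (hW : p.IsSolution W) (i : Fin n)
    (x : ℝ≥0) : p.value i x ≤ W i x := by
  obtain ⟨r, hr, hrle⟩ := p.exists_lintegral_exp_hold_le (half_pos p.δ_pos)
  refine le_of_forall_le_add_pow hr (A := ENNReal.ofReal (x + 2 * p.c / p.δ))
    ENNReal.ofReal_ne_top fun k => ?_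
  -- Each round replaces the terminal payoff `V` by `W` after one more jump, at the price of one
  -- more factor `r`; the start is the linear bound on `V`.
  induction k generalizing i x with
  | zero =>
    rw [pow_zero, one_mul]
    exact (p.value_le_two_mul i x).trans le_add_self
  | succ k ih =>
    refine (p.value_le_oneStepValue i x).trans (iSup₂_le fun D (hD : p.IsAdmissible i x D) => ?_)
    obtain ⟨d, hd, -, hDd⟩ := hD.exists_path
    have hWD : p.oneStepPayoff W i x D ≤ W i x := by
      rw [hW.2 i x]
      exact le_iSup₂ (f := fun D (_ : D ∈ p.admissible i x) => p.oneStepPayoff W i x D) D hD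
    refine le_trans ?_ (add_le_add_left hWD _)
    rw [oneStepPayoff_eq hD.path hd hDd p.measurable_value, oneStepPayoff_eq hD.path hd hDd hW.1,
      pow_succ', mul_assoc]
    refine p.lintegral_add_exp_le (ENNReal.mul_ne_top (ENNReal.pow_ne_top hr.ne_top)
      ENNReal.ofReal_ne_top) (hrle i) (Eventually.of_forall fun a => ?_)
    rw [add_assoc]
    refine add_le_add_right ?_ _
    by_cases hy : 0 ≤ p.nextSurplus i x d a
    · simp only [extendZero, if_pos hy]
      exact p.exp_mul_add_le hd (ih _ _) hy
    · simp [extendZero, if_neg hy]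

/-! ### Barrier strategies -/

theorem payoff_congr {i : Fin n} {x : ℝ≥0} {D D' : DividendProcess n}
    (h : ∀ᵐ ω ∂p.P, ∀ t, D t ω = D' t ω) : p.payoff i x D = p.payoff i x D' := by
  refine lintegral_congr_ae ?_
  filter_upwards [h] with ω hω
  simp only [ruinTime, surplus, hω]

theorem bddAbove_barrier (b : Fin n → ℝ≥0) (i : Fin n) (x t : ℝ≥0) (ω : PathSpace n) :
    BddAbove (range fun s : Iio t => max (p.reserve i x s ω - b (phase i s ω)) 0) := by
  have hc := p.c_pos
  refine ⟨x + p.c * t, ?_⟩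
  rintro _ ⟨s, rfl⟩
  have hs : ((s : ℝ≥0) : ℝ) ≤ t := by exact_mod_cast (mem_Iio.1 s.2).le
  have h1 := aggregateClaims_nonneg i s ω
  have h2 := mul_le_mul_of_nonneg_left hs hc.le
  have h3 := (b (phase i s ω)).coe_nonneg
  refine max_le ?_ (by positivity)
  rw [reserve]
  linarith

/-- Let `M` be the running supremum at the first jump. Without dividends, the surplus on the
original path after the jump is the one restarted from the new state plus `M`. The supremum up to `τ
+ t` is thus the larger of `M` and `M` plus the new excess, which is `M` plus the new barrier
payments, thanks to the positive part. -/
theorem barrierStrategy_consPath_add {b : Fin n → ℝ≥0} {i : Fin n} {x : ℝ≥0} {a : StepNoise n}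
    {ω : PathSpace n} (hω : IsNonexplosive ω) {d : ℝ≥0 → ℝ}
    (hd : p.barrierStrategy b i x (a.1 i).1 (consPath a ω) = d (a.1 i).1)
    (hy : 0 ≤ p.nextSurplus i x d a) (t : ℝ≥0) :
    residual (p.barrierStrategy b i x) i a t ω =
      p.barrierStrategy b (nextPhase i a) (p.nextSurplus i x d a).toNNReal t ω := by
  set τ := (a.1 i).1 with hτ
  set M := p.barrierStrategy b i x τ (consPath a ω) with hM
  have hM0 : 0 ≤ M := Real.iSup_nonneg fun _ => le_max_right _ _
  have hres : ∀ u, p.reserve i x (τ + u) (consPath a ω) =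
      p.reserve (nextPhase i a) (p.nextSurplus i x d a).toNNReal u ω + M := by
    intro u
    rw [reserve, reserve, aggregateClaims_consPath_add hω, Real.coe_toNNReal _ hy, nextSurplus,
      ← hτ, ← hd]
    push_cast
    ring
  have hph : ∀ u, phase i (τ + u) (consPath a ω) = phase (nextPhase i a) u ω :=
    phase_consPath_add hω i a
  change p.barrierStrategy b i x (τ + t) (consPath a ω) - M = _
  refine le_antisymm ?_ ?_
  · rw [sub_le_iff_le_add]
    have hG : 0 ≤ p.barrierStrategy b (nextPhase i a) (p.nextSurplus i x d a).toNNReal t ω :=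
      Real.iSup_nonneg fun _ => le_max_right _ _
    refine Real.iSup_le (fun s => ?_) (add_nonneg hG hM0)
    rcases lt_or_ge (s : ℝ≥0) τ with h | h
    · have := le_ciSup (p.bddAbove_barrier b i x τ (consPath a ω)) ⟨s, h⟩
      exact le_trans this (le_add_of_nonneg_left hG)
    · obtain ⟨u, hu⟩ := exists_add_of_le h
      have hut : u < t := lt_of_add_lt_add_left (a := τ) (hu ▸ s.2)
      have := le_ciSup (p.bddAbove_barrier b (nextPhase i a)
        (p.nextSurplus i x d a).toNNReal t ω) ⟨u, hut⟩
      dsimp only at this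
      rw [hu, hres, hph]
      refine max_le ?_ (add_nonneg hG hM0)
      have h1 := (le_max_left _ _).trans this
      rw [barrierStrategy]
      linarith
  · have hF : 0 ≤ p.barrierStrategy b i x (τ + t) (consPath a ω) :=
      Real.iSup_nonneg fun _ => le_max_right _ _
    have hMF : M ≤ p.barrierStrategy b i x (τ + t) (consPath a ω) :=
      Real.iSup_le (fun s => le_ciSup (p.bddAbove_barrier b i x (τ + t) (consPath a ω))
        ⟨s, (mem_Iio.1 s.2).trans_le le_self_add⟩) hF
    refine Real.iSup_le (fun s => max_le ?_ (sub_nonneg.2 hMF)) (sub_nonneg.2 hMF)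
    have := le_ciSup (p.bddAbove_barrier b i x (τ + t) (consPath a ω))
      ⟨τ + s, add_lt_add_right (mem_Iio.1 s.2) τ⟩
    dsimp only at this
    rw [hres, hph] at this
    have h1 := (le_max_left _ _).trans this
    rw [barrierStrategy]
    linarith

/-- A barrier strategy that is optimal for all one-step problems attains the value function. -/
theorem value_le_payoff_barrierStrategy {b : Fin n → ℝ≥0}
    (hb : ∀ i x, IsOptimalStrategy (p.admissible i x) (p.oneStepPayoff p.value i x)
      (p.barrierStrategy b i x)) (i : Fin n) (x : ℝ≥0) :
    p.value i x ≤ p.payoff i x (p.barrierStrategy b i x) := by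
  obtain ⟨r, hr, hrle⟩ := p.exists_lintegral_exp_hold_le (half_pos p.δ_pos)
  refine le_of_forall_le_add_pow hr (A := ENNReal.ofReal (x + 2 * p.c / p.δ))
    ENNReal.ofReal_ne_top fun k => ?_
  induction k generalizing i x with
  | zero =>
    rw [pow_zero, one_mul]
    exact (p.value_le_two_mul i x).trans le_add_self
  | succ k ih =>
    have hD : p.IsAdmissible i x (p.barrierStrategy b i x) := (hb i x).1
    obtain ⟨d, hd, -, hDd⟩ := hD.exists_path
    -- One-step optimality puts the barrier strategy in place of the supremum; only the payoffs
    -- after the jump remain to be compared.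
    refine (p.value_le_oneStepValue i x).trans ((iSup₂_le (hb i x).2).trans ?_)
    rw [oneStepPayoff_eq hD.path hd hDd p.measurable_value, hD.payoff_eq hd hDd,
      pow_succ', mul_assoc]
    refine p.lintegral_add_exp_le (ENNReal.mul_ne_top (ENNReal.pow_ne_top hr.ne_top)
      ENNReal.ofReal_ne_top) (hrle i) ?_
    filter_upwards [hD.ae_split hDd] with a ha
    rw [add_assoc]
    refine add_le_add_right ?_ _
    by_cases hy : 0 ≤ p.nextSurplus i x d a
    · have hpay : p.payoff (nextPhase i a) (p.nextSurplus i x d a).toNNReal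
          (residual (p.barrierStrategy b i x) i a) =
          p.payoff (nextPhase i a) (p.nextSurplus i x d a).toNNReal
            (p.barrierStrategy b (nextPhase i a) (p.nextSurplus i x d a).toNNReal) := by
        refine p.payoff_congr ?_
        filter_upwards [ha] with ω hω t
        exact p.barrierStrategy_consPath_add hω.1.nonexplosive (hω.2.2 _ le_rfl) hy t
      simp only [extendZero, if_pos hy]
      rw [hpay]
      exact p.exp_mul_add_le hd (ih _ _) hy
    · simp [extendZero, if_neg hy]

end RiskParams

end

theorem mainTheorem6 {n : ℕ} (p : RiskParams n) :
    (∀ i x, p.value i x < ⊤) ∧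
    IsLeast {W : Fin n → ℝ≥0 → ℝ≥0∞ | p.IsSolution W} p.value ∧
    ∀ b : Fin n → ℝ≥0,
      (∀ i x, IsOptimalStrategy (p.admissible i x) (p.oneStepPayoff p.value i x)
        (p.barrierStrategy b i x)) →
      ∀ i x, IsOptimalStrategy (p.admissible i x) (p.payoff i x) (p.barrierStrategy b i x) :=
  ⟨p.value_lt_top,
    ⟨p.isSolution_value, fun _ hW i x => p.value_le_of_isSolution hW i x⟩,
    fun _ hb i x => ⟨(hb i x).1, fun _ hD =>
      (p.payoff_le_value hD).trans (p.value_le_payoff_barrierStrategy hb i x)⟩⟩
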